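/- **The routine.** Let $q\ge 0$, and let $U$ be a unitary on $q$ qubits with $U|0^q\rangle=e^{i\gamma}\sum_{j}\alpha_j|j\rangle$, where $\gamma\in\mathbb R$ and all $\alpha_j$ are real; $j$ ranges over the $2^q$ bit strings. The controlled version of $U$ that is available is $|0\rangle\langle 0|\otimes I+|1\rangle\langle 1|\otimes V$ with $V=e^{-i\gamma}U$, so that $V|0^q\rangle=\sum_j\alpha_j|j\rangle$. Let $k$ be a basis index and $\epsilon>0$. Let $X_k$ be the product of Pauli $X$ gates that maps $|0^q\rangle$ to $|k\rangle$, and let $$A=(H\otimes I)\,\bigl(|0\rangle\langle0|\otimes X_k+|1\rangle\langle1|\otimes I\bigr)\,\bigl(|0\rangle\langle0|\otimes I+|1\rangle\langle1|\otimes V\bigr)\,(H\otimes I)$$ on one auxiliary and $q$ data qubits. The routine $\mathrm{SignEstNFP}(U,k,\epsilon)$ applies amplitude estimation to the basis state $|0\rangle\otimes|k\rangle$ of $A|0^{q+1}\rangle$ with $t=\lceil\log_2(9\sqrt3\,\pi/\epsilon)\rceil+2$ qubits of accuracy (a negative ceiling is replaced by $0$). That is, it performs phase estimation (Hadamard gates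 on $t$ qubits, the map $|j\rangle|y\rangle\mapsto|j\rangle Q^j|y\rangle$, the inverse quantum Fourier transform) on $A|0^{q+1}\rangle$ with the Grover iterator $Q=-A S_0A^\dagger S_{\rm good}$, where $S_0$ and $S_{\rm good}$ change the sign of $|0^{q+1}\rangle$ and of $|0\rangle\otimes|k\rangle$ respectively. It measures the $t$ qubits, obtaining $a\in\{0,1\}^t$, and sets $f=0.a$ if $0.a<\frac12$ and $f=1-0.a$ otherwise. It returns $1$ if $f>\frac16-\frac{2\epsilon}{3\sqrt3\,\pi}$, and $0$ otherwise. **Proposition (SignEstNFP).** (1) For all such $q,U,\gamma,\alpha,k,\epsilon$, with probability at least $3/4$ all of the following hold: - if $\alpha_k\le-\epsilon$, the routine returns $0$; and if it returns $0$, then $\alpha_k\le\frac13\epsilon$; - if $\alpha_k>\frac13\epsilon$, the routine returns $1$; and if it returns $1$, then $\alpha_k>-\epsilon$. (2) There is an absolute constant $C$ such that for all $q\ge1$, all $k$ and all $0<\epsilon\le1$ there is a quantum circuit, not depending on $U$ or $\gamma$, that performs the routine for every unitary $U$ on $q$ qubits and every real $\gamma$. Started in the all-zero state, its exact final state is the state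 of the routine before the measurement, with the returned value (as a function of the phase register) written into an output qubit and all ancillas back in $|0\rangle$. The circuit consists of basic gates (one-qubit unitaries with at most two control qubits), calls of $U$, $U^\dagger$ and controlled $V$, $V^\dagger$, and calls of one subcircuit, built from the same gates and calls, which performs the controlled Grover iterator $Q$. Its cost is as follows. - It makes at most $C/\epsilon$ calls in total to $U,U^\dagger$ or their controlled versions, including all those made inside the executed subcircuit calls. - It calls the subcircuit at most $C/\epsilon$ times. - The additional gates number at most $C\,q$ in the subcircuit (counted once, not once per call), and at most $C\,(q+\log_2^2\frac1\epsilon)$ outside of it. -/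

import Mathlib

open scoped Kronecker Matrix

namespace SignEst

/-! ## Linear algebra of qubit registers -/

/-- Labels of the computational basis of `n` qubits; the bit with index `0` is the most
significant one. -/
abbrev Bits (n : ℕ) : Type := Fin n → Bool

/-- The all-zero bit string. -/
def zeros (n : ℕ) : Bits n := fun _ => false

/-- The integer whose binary expansion is `a`. -/
def val {t : ℕ} (a : Bits t) : ℕ := ∑ i : Fin t, if a i then 2 ^ (t - 1 - (i : ℕ)) else 0

/-- The binary fraction `0.a`. -/
noncomputable def frac {t : ℕ} (a : Bits t) : ℝ :=
  ∑ i : Fin t, if a i then (1 / 2 : ℝ) ^ ((i : ℕ) + 1) else 0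

/-- The basis vector with label `v`. -/
def ket {ι : Type*} [DecidableEq ι] (v : ι) : ι → ℂ := Pi.single v 1

/-- The projector onto the basis vector with label `v`. -/
def proj {ι : Type*} [DecidableEq ι] (v : ι) : Matrix ι ι ℂ := Matrix.single v v 1

/-- The one-qubit Hadamard gate. -/
noncomputable def hadamard : Matrix Bool Bool ℂ :=
  Matrix.of fun a b => (if a && b then -1 else 1) / (Real.sqrt 2 : ℂ)

/-- A Hadamard gate on each of `t` qubits. -/
noncomputable def hadamards (t : ℕ) : Matrix (Bits t) (Bits t) ℂ :=
  Matrix.of fun a b => ∏ i, hadamard (a i) (b i)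

/-- The quantum Fourier transform on `t` qubits. -/
noncomputable def qft (t : ℕ) : Matrix (Bits t) (Bits t) ℂ :=
  Matrix.of fun a b =>
    Complex.exp (2 * Real.pi * Complex.I * (val a * val b : ℕ) / (2 ^ t : ℕ))
      / (Real.sqrt (2 ^ t) : ℂ)

/-- The product of Pauli `X` gates that maps the all-zero basis state to the one labelled `k`. -/
def flip {q : ℕ} (k : Bits q) : Matrix (Bits q) (Bits q) ℂ :=
  Matrix.of fun i j => if i = fun l => xor (j l) (k l) then 1 else 0

/-- `U` applied to the second register if the first qubit is in state `b`. -/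
def controlled {ι : Type*} [DecidableEq ι] (b : Bool) (U : Matrix ι ι ℂ) :
    Matrix (Bool × ι) (Bool × ι) ℂ :=
  proj (!b) ⊗ₖ (1 : Matrix ι ι ℂ) + proj b ⊗ₖ U

/-! ## Amplitude estimation -/

/-- The reflection that changes the sign of the basis vector with label `v`. -/
def reflection {ι : Type*} [DecidableEq ι] (v : ι) : Matrix ι ι ℂ := 1 - (2 : ℂ) • proj v

/-- The Grover iterator `- A S_zero A† S_good` for the state preparation `A`, where `zero` labels
the initial state and `good` the basis state whose amplitude is estimated. -/
def grover {ι : Type*} [Fintype ι] [DecidableEq ι] (A : Matrix ι ι ℂ) (zero good : ι) :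
    Matrix ι ι ℂ :=
  -(A * reflection zero * Aᴴ * reflection good)

/-- The map `|j⟩|y⟩ ↦ |j⟩ Q^j |y⟩` of phase estimation with `t` qubits. -/
def powers {ι : Type*} [Fintype ι] [DecidableEq ι] (t : ℕ) (Q : Matrix ι ι ℂ) :
    Matrix (Bits t × ι) (Bits t × ι) ℂ :=
  Matrix.of fun x y => if x.1 = y.1 then (Q ^ val x.1) x.2 y.2 else 0

/-- The state of amplitude estimation with `t` qubits of accuracy just before the first register
is measured: phase estimation of the Grover iterator on the state prepared by `A`. -/
noncomputable def ampEstState {ι : Type*} [Fintype ι] [DecidableEq ι] (t : ℕ)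
    (A : Matrix ι ι ℂ) (zero good : ι) : Bits t × ι → ℂ :=
  (((qft t)ᴴ ⊗ₖ (1 : Matrix ι ι ℂ)) * powers t (grover A zero good) * (hadamards t ⊗ₖ A))
    *ᵥ ket (zeros t, zero)

/-! ## The sign estimation routine without false positives -/

/-- The number of qubits of accuracy. -/
noncomputable def accuracy (ε : ℝ) : ℕ :=
  ⌈Real.logb 2 (9 * Real.sqrt 3 * Real.pi / ε)⌉₊ + 2

/-- The unitary performed on the auxiliary qubit and the `q` data qubits before amplitude
estimation; `V` is the unitary of which the controlled version is applied. -/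
noncomputable def prep {q : ℕ} (V : Matrix (Bits q) (Bits q) ℂ) (k : Bits q) :
    Matrix (Bool × Bits q) (Bool × Bits q) ℂ :=
  (hadamard ⊗ₖ (1 : Matrix (Bits q) (Bits q) ℂ)) * controlled false (flip k) *
    controlled true V * (hadamard ⊗ₖ (1 : Matrix (Bits q) (Bits q) ℂ))

/-- The Grover iterator used by the routine; the good state is `|0⟩ ⊗ |k⟩`. -/
noncomputable def iterator {q : ℕ} (V : Matrix (Bits q) (Bits q) ℂ) (k : Bits q) :
    Matrix (Bool × Bits q) (Bool × Bits q) ℂ :=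
  grover (prep V k) (false, zeros q) (false, k)

/-- The state of the routine just before the measurement. -/
noncomputable def finalState {q : ℕ} (V : Matrix (Bits q) (Bits q) ℂ) (k : Bits q) (ε : ℝ) :
    Bits (accuracy ε) × (Bool × Bits q) → ℂ :=
  ampEstState (accuracy ε) (prep V k) (false, zeros q) (false, k)

/-- The value returned by the routine when the phase register holds `a`
(`true` is `1`, `false` is `0`). -/
noncomputable def returnValue {t : ℕ} (ε : ℝ) (a : Bits t) : Bool :=
  if frac a < 1 / 2 then
    decide (frac a > 1 / 6 - 2 * ε / (3 * Real.sqrt 3 * Real.pi))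
  else
    decide (1 - frac a > 1 / 6 - 2 * ε / (3 * Real.sqrt 3 * Real.pi))

open Classical in
/-- The probability that the value returned by the routine satisfies `P`. -/
noncomputable def probReturn {q : ℕ} (V : Matrix (Bits q) (Bits q) ℂ) (k : Bits q) (ε : ℝ)
    (P : Bool → Prop) : ℝ :=
  ∑ a : Bits (accuracy ε), if P (returnValue ε a) then
    ∑ y : Bool × Bits q, ‖finalState V k ε (a, y)‖ ^ 2 else 0

/-! ## Quantum circuits with oracle calls -/

/-- The operator `M` applied to the wires selected by `f`, controlled by the wires in `c`. -/
noncomputable def applyOn {W κ : Type*} [Fintype κ] [DecidableEq κ] (c : Finset W) (f : κ ↪ W)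
    (M : Matrix (κ → Bool) (κ → Bool) ℂ) (ψ : (W → Bool) → ℂ) : (W → Bool) → ℂ :=
  fun x => if ∀ w ∈ c, x w = true then
    ∑ y : κ → Bool, M (fun i => x (f i)) y * ψ (Function.extend f y x) else ψ x

/-- A basic gate: a one-qubit unitary with at most two control qubits. -/
structure BasicGate (W : Type*) where
  target : W
  controls : Finset W
  card_controls : controls.card ≤ 2
  target_notMem : target ∉ controls
  u : Matrix.unitaryGroup Bool ℂ

noncomputable def BasicGate.apply {W : Type*} [DecidableEq W] (g : BasicGate W)
    (ψ : (W → Bool) → ℂ) : (W → Bool) → ℂ :=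
  fun x => if ∀ w ∈ g.controls, x w = true then
    ∑ b : Bool, (g.u : Matrix Bool Bool ℂ) (x g.target) b * ψ (Function.update x g.target b)
  else ψ x

/-- An elementary operation: a basic gate, a call of the oracle, or a call of its controlled
version; `adj` tells whether the inverse is called. -/
inductive Op (q : ℕ) (W : Type*) where
  | gate (g : BasicGate W)
  | query (adj : Bool) (f : Fin q ↪ W)
  | cquery (adj : Bool) (c : W) (f : Fin q ↪ W) (hc : ∀ i, f i ≠ c)

/-- The action of an operation; `U` is the oracle and `V` the unitary of which the controlled
version is available. -/
noncomputable def Op.apply {q : ℕ} {W : Type*} [DecidableEq W]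
    (U V : Matrix (Bits q) (Bits q) ℂ) : Op q W → ((W → Bool) → ℂ) → ((W → Bool) → ℂ)
  | .gate g, ψ => g.apply ψ
  | .query adj f, ψ => applyOn ∅ f (if adj then Uᴴ else U) ψ
  | .cquery adj c f _, ψ => applyOn {c} f (if adj then Vᴴ else V) ψ

def Op.isGate {q : ℕ} {W : Type*} : Op q W → Bool
  | .gate _ => true
  | _ => false

/-- A step of the main circuit: an elementary operation, or one call of the subcircuit. -/
inductive Step (q : ℕ) (W : Type*) where
  | op (o : Op q W)
  | sub

/-- The wires: `t` qubits for the phase and the working register (one auxiliary and `q` data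
qubits), then one qubit for the returned value and `m` ancillas. -/
abbrev Wire (t q m : ℕ) : Type := (Fin t ⊕ (Unit ⊕ Fin q)) ⊕ (Unit ⊕ Fin m)

namespace Wire
variable {t q m : ℕ}
abbrev phase (i : Fin t) : Wire t q m := .inl (.inl i)
abbrev aux : Wire t q m := .inl (.inr (.inl ()))
abbrev data (i : Fin q) : Wire t q m := .inl (.inr (.inr i))
abbrev out : Wire t q m := .inr (.inl ())
abbrev ancilla (i : Fin m) : Wire t q m := .inr (.inr i)
end Wire

/-- The wires of the working register. -/
def workingRegister (t q m : ℕ) : Unit ⊕ Fin q ↪ Wire t q m :=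
  ⟨fun i => .inl (.inr i), fun _ _ h => Sum.inr_injective (Sum.inl_injective h)⟩

/-- An operator on the auxiliary and data qubits, with its basis labelled by the wires. -/
def onWires {q : ℕ} (M : Matrix (Bool × Bits q) (Bool × Bits q) ℂ) :
    Matrix (Unit ⊕ Fin q → Bool) (Unit ⊕ Fin q → Bool) ℂ :=
  M.submatrix (fun z => (z (.inl ()), fun i => z (.inr i)))
    (fun z => (z (.inl ()), fun i => z (.inr i)))

/-- A circuit with one subcircuit, which is controlled by the ancilla `ctrl`. -/
structure Circuit (t q m : ℕ) where
  main : List (Step q (Wire t q m))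
  body : List (Op q (Wire t q m))
  ctrl : Fin m

namespace Circuit
variable {t q m : ℕ}

/-- The action of the subcircuit. -/
noncomputable def runBody (P : Circuit t q m) (U V : Matrix (Bits q) (Bits q) ℂ)
    (ψ : (Wire t q m → Bool) → ℂ) : (Wire t q m → Bool) → ℂ :=
  P.body.foldl (fun φ o => o.apply U V φ) ψ

/-- The action of one step of the main circuit. -/
noncomputable def runStep (P : Circuit t q m) (U V : Matrix (Bits q) (Bits q) ℂ)
    (ψ : (Wire t q m → Bool) → ℂ) : Step q (Wire t q m) → ((Wire t q m → Bool) → ℂ)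
  | .op o => o.apply U V ψ
  | .sub => P.runBody U V ψ

/-- The state produced from the all-zero basis state; the head of the list acts first. -/
noncomputable def run (P : Circuit t q m) (U V : Matrix (Bits q) (Bits q) ℂ) :
    (Wire t q m → Bool) → ℂ :=
  P.main.foldl (P.runStep U V) (ket fun _ => false)

/-- Calls of the subcircuit. -/
def subCalls (P : Circuit t q m) : ℕ :=
  P.main.countP fun s => match s with
    | .sub => true
    | .op _ => false

/-- Basic gates in the main circuit, outside the calls of the subcircuit. -/
def mainGates (P : Circuit t q m) : ℕ :=
  P.main.countP fun s => match s with
    | .sub => false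
    | .op o => o.isGate

/-- Basic gates in the subcircuit. -/
def bodyGates (P : Circuit t q m) : ℕ := P.body.countP Op.isGate

/-- Executed calls of the oracle, its inverse, and their controlled versions. -/
def queries (P : Circuit t q m) : ℕ :=
  (P.main.countP fun s => match s with
    | .sub => false
    | .op o => !o.isGate) + P.subCalls * P.body.countP fun o => !o.isGate

/-- The subcircuit performs the controlled version of `Q` on the working register whenever all
ancillas other than the control are zero, and leaves them zero. -/
def BodyPerforms (P : Circuit t q m) (U V : Matrix (Bits q) (Bits q) ℂ)
    (Q : Matrix (Bool × Bits q) (Bool × Bits q) ℂ) : Prop :=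
  ∀ ψ : (Wire t q m → Bool) → ℂ,
    (∀ x, (∃ i, i ≠ P.ctrl ∧ x (Wire.ancilla i) = true) → ψ x = 0) →
    P.runBody U V ψ = applyOn {Wire.ancilla P.ctrl} (workingRegister t q m) (onWires Q) ψ

end Circuit

/-- The state `∑ φ(a, y) |a⟩|y⟩|r(a)⟩|0⟩`: the output qubit holds the value computed from the
phase register, and the ancillas are zero. -/
def withOutput {t q : ℕ} (m : ℕ) (φ : Bits t × (Bool × Bits q) → ℂ) (r : Bits t → Bool) :
    (Wire t q m → Bool) → ℂ :=
  fun x =>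
    if x Wire.out = r (fun i => x (Wire.phase i)) ∧ ∀ i, x (Wire.ancilla i) = false then
      φ (fun i => x (Wire.phase i), x Wire.aux, fun i => x (Wire.data i))
    else 0

/-- The circuit performs the routine with the oracle `U`: its subcircuit is the controlled Grover
iterator, and its final state is that of the routine with the returned value in the output
qubit. -/
def Circuit.Performs {q m : ℕ} (ε : ℝ) (P : Circuit (accuracy ε) q m)
    (U V : Matrix (Bits q) (Bits q) ℂ) (k : Bits q) : Prop :=
  P.BodyPerforms U V (iterator V k) ∧
    P.run U V = withOutput m (finalState V k ε) (returnValue ε)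

end SignEst

namespace SignEst

/-! Part (1). The good state has amplitude `(1 + α k) / 2 = sin θ` (`prep_good`), so the sign of `α
k` becomes the question on which side of `π / 6` the angle `θ` lies. In the plane spanned by the
good state and the normalized rest of the prepared state, the Grover iterator rotates by `2 θ`
(`grover_pow_mulVec`); its eigenphases are `±θ / π`, and the phase register is distributed as the
mean of the two corresponding phase estimation distributions (`rotation_fourier_normSq`,
`ampEst_prob`). For each of them the two grid points around the phase carry mass at least `sinc²
(πx) + sinc² (π(x - 1)) ≥ 3/4` (`three_quarters_le_sum_phaseKernel`). The number `f` is the distance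
of `0.a` to the nearest integer, hence blind to the sign of the eigenphase, and lies within `2^(-t)
≤ ε / (36√3π)` of `θ / π` with probability at least `3/4`. If `α k ≤ -ε`, concavity of the sine
gives `θ / π ≤ (1 - ε) / 6`; if `α k > ε / 3`, then `θ / π ≥ 1 / 6`. The threshold separates the two
cases with this margin (`returnValue_of_near`).

Part (2). In the controlled iterator only the two reflections and the overall sign need a control:
with the control off, `A` and `A†` cancel. So one subcircuit call costs two oracle calls
(`runOps_bodyOps`). Each reflection is a sign change by a bit that a ladder of `X` gates with at
most two controls computes into ancillas and then uncomputes, with `O(q)` gates. Powers are repeated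
calls, `2^t - 1` in all.

The Fourier transform is the usual circuit of `O(t²)` gates without the bit reversal. Instead, phase
qubit `i` controls the power `2^i`, and reindexing the sum over the phase register by reversal
yields exactly the required state (`signEstCircuit_run`). The routine returns `1` on an interval of
outcomes, so its value is the xor of two comparisons with constants (`exists_returnValue_eq_xor`),
again computed by ladders. The bounds `t ≤ log₂ (1/ε) + 9` and `2^t ≤ 512 / ε` turn the counts into
the stated cost. -/

theorem val_cons {t : ℕ} (b : Bool) (a : Bits t) :
    val (Fin.cons b a : Bits (t + 1)) = (if b then 2 ^ t else 0) + val a := by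
  simp only [val, Fin.sum_univ_succ, Fin.cons_zero, Fin.cons_succ, Fin.val_succ]
  congr 1
  refine Finset.sum_congr rfl fun i _ => ?_
  congr 2
  omega

/-- Binary expansion is a bijection onto `[0, 2^t)`: the most significant bit decides between the
lower and the upper half of the range. -/
theorem sum_val {M : Type*} [AddCommMonoid M] (t : ℕ) (F : ℕ → M) :
    ∑ a : Bits t, F (val a) = ∑ n ∈ Finset.range (2 ^ t), F n := by
  induction t generalizing F with
  | zero => simp [val]
  | succ t ih =>
    rw [← (Fin.consEquiv fun _ : Fin (t + 1) => Bool).sum_comp, Fintype.sum_prod_type,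
      Fintype.sum_bool]
    simp only [Fin.consEquiv, Equiv.coe_fn_mk, val_cons]
    have h := ih fun n => F (2 ^ t + n)
    simp only [if_true, Bool.false_eq_true, if_false, zero_add]
    rw [h, ih, pow_succ, mul_two, Finset.sum_range_add, add_comm]

theorem frac_eq {t : ℕ} (a : Bits t) : frac a = val a / 2 ^ t := by
  simp only [frac, val, Nat.cast_sum, Finset.sum_div]
  refine Finset.sum_congr rfl fun i _ => ?_
  split_ifs
  · rw [one_div, inv_pow, eq_div_iff (by positivity), inv_mul_eq_iff_eq_mul₀ (by positivity)]
    push_cast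
    rw [← pow_add]
    congr 1
    have := i.isLt
    omega
  · simp

/-! ### Amplitude estimation as phase estimation of a plane rotation -/

theorem mulVec_ket {ι κ : Type*} [Fintype ι] [DecidableEq ι] (M : Matrix κ ι ℂ) (v : ι) :
    M *ᵥ ket v = fun i => M i v := by
  ext i; simp [ket]

/-- The Hadamard gates and the inverse Fourier transform contribute `2^(-t/2)` each, so the
amplitudes are the normalized discrete Fourier coefficients of the orbit of the prepared state under
the Grover iterator. -/
theorem ampEstState_apply {ι : Type*} [Fintype ι] [DecidableEq ι] (t : ℕ)
    (A : Matrix ι ι ℂ) (zero good : ι) (a : Bits t) (y : ι) :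
    ampEstState t A zero good (a, y) =
      ∑ j : Bits t, Complex.exp (-(2 * Real.pi * Complex.I * (val j * val a : ℕ) / (2 ^ t : ℕ)))
        / (2 ^ t : ℕ) * ((grover A zero good ^ val j) *ᵥ (A *ᵥ ket zero)) y := by
  have h2 : ((Real.sqrt (2 ^ t) : ℝ) : ℂ) * ((Real.sqrt 2 : ℝ) : ℂ) ^ t = (2 ^ t : ℕ) := by
    have h : Real.sqrt (2 ^ t) * Real.sqrt 2 ^ t = 2 ^ t := by
      rw [Real.sqrt_eq_rpow, Real.sqrt_eq_rpow, ← Real.rpow_natCast, ← Real.rpow_natCast,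
        ← Real.rpow_mul (by norm_num), ← Real.rpow_mul (by norm_num),
        ← Real.rpow_add (by norm_num)]
      ring_nf
    exact_mod_cast h
  have hs : ∀ j : Bits t, (powers t (grover A zero good) *ᵥ ((hadamards t ⊗ₖ A) *ᵥ
      ket (zeros t, zero))) (j, y) = 1 / ((Real.sqrt 2 : ℝ) : ℂ) ^ t *
        ((grover A zero good ^ val j) *ᵥ (A *ᵥ ket zero)) y := by
    intro j
    rw [mulVec_ket, mulVec_ket]
    simp only [Matrix.mulVec, dotProduct, Fintype.sum_prod_type, powers,
      Matrix.of_apply, Matrix.kroneckerMap_apply, ite_mul, zero_mul]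
    rw [Finset.sum_eq_single j (fun _ _ h => by simp [h.symm]) (by simp), Finset.mul_sum]
    refine Finset.sum_congr rfl fun z _ => ?_
    simp [hadamards, hadamard, zeros]
    ring
  rw [ampEstState, ← Matrix.mulVec_mulVec, ← Matrix.mulVec_mulVec, Matrix.mulVec, dotProduct,
    Fintype.sum_prod_type]
  refine Finset.sum_congr rfl fun j _ => ?_
  rw [Finset.sum_eq_single y (fun _ _ h => by simp [Matrix.one_apply_ne h.symm]) (by simp), hs]
  simp only [Matrix.kroneckerMap_apply, Matrix.conjTranspose_apply, qft, Matrix.of_apply,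
    Matrix.one_apply_eq, star_div₀, mul_one, Complex.star_def, ← Complex.exp_conj, map_div₀,
    map_mul, Complex.conj_ofReal, Complex.conj_I, map_natCast, map_ofNat]
  have e : ∀ u v : ℂ, 2 * Real.pi * -Complex.I * u / v = -(2 * Real.pi * Complex.I * u / v) := by
    intro u v; ring
  rw [e]
  generalize Complex.exp _ = x
  rw [← h2]
  field_simp

/-- If the prepared state is `sin θ • good + cos θ • b` with `b` a unit vector orthogonal to the
good state, the Grover iterator rotates by `2 θ` in the plane they span. -/
theorem grover_pow_mulVec {ι : Type*} [Fintype ι] [DecidableEq ι] {A : Matrix ι ι ℂ}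
    (hA : A ∈ Matrix.unitaryGroup ι ℂ) (zero good : ι) (θ : ℝ) (b : ι → ℂ) (hb : b good = 0)
    (hb1 : star b ⬝ᵥ b = 1)
    (hψ : A *ᵥ ket zero = (Real.sin θ : ℂ) • ket good + (Real.cos θ : ℂ) • b) (j : ℕ) :
    (grover A zero good ^ j) *ᵥ (A *ᵥ ket zero) =
      (Real.sin ((2 * j + 1) * θ) : ℂ) • ket good + (Real.cos ((2 * j + 1) * θ) : ℂ) • b := by
  have hAA : A * Aᴴ = 1 := Matrix.mem_unitaryGroup_iff.1 hA
  -- Conjugation by `A` turns the reflection in the initial state into the reflection in the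
  -- prepared state; minus the product of this and `reflection good` is the rotation.
  have hr : ∀ v, (A * reflection zero * Aᴴ) *ᵥ v =
      v - (2 * (star (A *ᵥ ket zero) ⬝ᵥ v)) • (A *ᵥ ket zero) := by
    intro v
    have hp : A * proj zero * Aᴴ = Matrix.vecMulVec (A *ᵥ ket zero) (star (A *ᵥ ket zero)) := by
      ext i j
      simp [proj, mulVec_ket, Matrix.vecMulVec_apply, Matrix.mul_apply, Matrix.single_apply,
        ite_and]
    rw [reflection, mul_sub, sub_mul, mul_one, hAA, Matrix.mul_smul, Matrix.smul_mul, hp,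
      Matrix.sub_mulVec, Matrix.one_mulVec, Matrix.smul_mulVec, Matrix.vecMulVec_mulVec]
    ext i
    simp
    ring
  have hg : ∀ v, reflection good *ᵥ v = v - (2 * v good) • ket good := by
    intro v
    ext i
    rw [reflection, Matrix.sub_mulVec, Matrix.one_mulVec, Matrix.smul_mulVec]
    have : (proj good *ᵥ v) i = if i = good then v good else 0 := by
      simp only [proj, Matrix.mulVec, dotProduct, Matrix.single_apply, ite_mul, one_mul, zero_mul,
        ite_and]
      by_cases h : i = good
      · subst h; simp
      · simp [h, Ne.symm h]
    simp [this, ket, Pi.single_apply]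
  induction j with
  | zero => simp [hψ]
  | succ j ih =>
    rw [pow_succ', ← Matrix.mulVec_mulVec, ih, grover, Matrix.neg_mulVec, ← Matrix.mulVec_mulVec,
      hg, hr, hψ]
    have e1 : star ((Real.sin θ : ℂ) • ket good + (Real.cos θ : ℂ) • b) ⬝ᵥ ket good
        = Real.sin θ := by
      simp only [star_add, star_smul, add_dotProduct, smul_dotProduct]
      simp [ket, hb, -Complex.ofReal_sin]
    have e2 : star ((Real.sin θ : ℂ) • ket good + (Real.cos θ : ℂ) • b) ⬝ᵥ b
        = Real.cos θ := by
      have : star (ket good) ⬝ᵥ b = 0 := by simp [ket, hb]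
      rw [star_add, add_dotProduct, star_smul, star_smul, smul_dotProduct, smul_dotProduct, this,
        hb1]
      simp [-Complex.ofReal_cos, -Complex.ofReal_sin]
    have e3 : ket good good = (1 : ℂ) := by simp [ket]
    set s := Real.sin ((2 * j + 1) * θ)
    set c := Real.cos ((2 * j + 1) * θ)
    have hs : Real.sin ((2 * (j + 1 : ℕ) + 1) * θ) =
        s - 2 * s * Real.sin θ ^ 2 + 2 * c * Real.cos θ * Real.sin θ := by
      have : (2 * (j + 1 : ℕ) + 1) * θ = (2 * j + 1) * θ + 2 * θ := by push_cast; ring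
      rw [this, Real.sin_add, Real.sin_two_mul, Real.cos_two_mul, Real.cos_sq']
      ring
    have hc : Real.cos ((2 * (j + 1 : ℕ) + 1) * θ) =
        2 * c * Real.cos θ ^ 2 - c - 2 * s * Real.sin θ * Real.cos θ := by
      have : (2 * (j + 1 : ℕ) + 1) * θ = (2 * j + 1) * θ + 2 * θ := by push_cast; ring
      rw [this, Real.cos_add, Real.sin_two_mul, Real.cos_two_mul]
      ring
    have e4 : ((s : ℂ) • ket good + (c : ℂ) • b) good = s := by simp [hb, e3]
    rw [e4, dotProduct_sub, dotProduct_add, dotProduct_smul, dotProduct_smul, dotProduct_smul, e1,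
      e2, hs, hc]
    ext i
    simp only [Pi.neg_apply, Pi.sub_apply, Pi.add_apply, Pi.smul_apply, smul_eq_mul]
    push_cast
    ring

/-- Phase estimation of a rotation: the outcome distribution is the average of those of the two
eigenphases. -/
theorem rotation_fourier_normSq {ι : Type*} [Fintype ι] [DecidableEq ι] {κ : Type*}
    (s : Finset κ) (w : κ → ℂ) (φ : κ → ℝ) (good : ι) (b : ι → ℂ) (hb : b good = 0)
    (hb1 : star b ⬝ᵥ b = 1) :
    ∑ y, ‖∑ j ∈ s, w j * ((Real.sin (φ j) : ℂ) • ket good + (Real.cos (φ j) : ℂ) • b) y‖ ^ 2 =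
      (‖∑ j ∈ s, w j * Complex.exp (φ j * Complex.I)‖ ^ 2 +
        ‖∑ j ∈ s, w j * Complex.exp (-φ j * Complex.I)‖ ^ 2) / 2 := by
  set S := ∑ j ∈ s, w j * (Real.sin (φ j) : ℂ) with hS
  set C := ∑ j ∈ s, w j * (Real.cos (φ j) : ℂ) with hC
  have h1 : ∀ y, ∑ j ∈ s, w j * ((Real.sin (φ j) : ℂ) • ket good + (Real.cos (φ j) : ℂ) • b) y
      = S * ket good y + C * b y := by
    intro y
    rw [hS, hC, Finset.sum_mul, Finset.sum_mul, ← Finset.sum_add_distrib]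
    refine Finset.sum_congr rfl fun j _ => ?_
    simp
    ring
  have h2 : ∑ j ∈ s, w j * Complex.exp (φ j * Complex.I) = C + Complex.I * S := by
    rw [hS, hC, Finset.mul_sum, ← Finset.sum_add_distrib]
    refine Finset.sum_congr rfl fun j _ => ?_
    rw [Complex.exp_mul_I]
    push_cast
    ring
  have h3 : ∑ j ∈ s, w j * Complex.exp (-φ j * Complex.I) = C - Complex.I * S := by
    rw [hS, hC, Finset.mul_sum, ← Finset.sum_sub_distrib]
    refine Finset.sum_congr rfl fun j _ => ?_
    rw [Complex.exp_mul_I, Complex.cos_neg, Complex.sin_neg]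
    push_cast
    ring
  have h4 : ∀ y, ‖S * ket good y + C * b y‖ ^ 2 =
      ‖S‖ ^ 2 * (if y = good then 1 else 0) + ‖C‖ ^ 2 * ‖b y‖ ^ 2 := by
    intro y
    by_cases h : y = good
    · subst h; simp [ket, hb]
    · simp [ket, h, mul_pow]
  have h5 : ∑ y, ‖b y‖ ^ 2 = (1 : ℝ) := by
    have : ((∑ y, ‖b y‖ ^ 2 : ℝ) : ℂ) = 1 := by
      rw [← hb1]
      simp [dotProduct, Complex.conj_mul']
    exact_mod_cast this
  -- As the good state and `b` are orthonormal, the left side is `|S|² + |C|²`, while the two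
  -- exponential sums are `C ± iS`.
  have h6 := parallelogram_law_with_norm ℝ C (Complex.I * S)
  have h7 : ‖Complex.I * S‖ = ‖S‖ := by simp
  simp only [h1, h2, h3, h4, Finset.sum_add_distrib, ← Finset.mul_sum, h5]
  simp
  rw [h7] at h6
  nlinarith

/-! ### The mass of phase estimation on the two grid points around the phase -/

/-- The cubic Taylor bound suffices: on this range the cubic term is at most `π x²`, because `π² x /
6 < 1`. -/
theorem pi_mul_le_sin {x : ℝ} (h0 : 0 < x) (h1 : x ≤ 1 / 2) :
    Real.pi * (x * (1 - x)) ≤ Real.sin (Real.pi * x) := by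
  have hpi := Real.pi_gt_three
  have hpi' := Real.pi_lt_d2
  have h := Real.sin_gt_sub_cube (x := Real.pi * x) (by positivity)
  have : Real.pi * x * (Real.pi ^ 2 * x ^ 2 / 6) ≤ Real.pi * x * x := by
    gcongr
    have : Real.pi ^ 2 ≤ 10 := by nlinarith
    nlinarith
  nlinarith

/-- Here `0.9254` is an upper bound for `3π² / 32`, and the quadratic in `u` is the lower bound for
`sin (πx)` used in the next lemma, with `u = (2x - 1)²`. -/
theorem quartic_sq_ge {u : ℝ} (h0 : 0 ≤ u) (h1 : u ≤ 1 / 2) :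
    9254 / 10000 * (1 - u) ^ 2 ≤ (1 - 1234 / 1000 * u + 19 / 100 * u ^ 2) ^ 2 * (1 + u) := by
  have a1 : 0 ≤ u * (u - 1 / 2) ^ 2 := by positivity
  have a2 : 0 ≤ u ^ 3 * (1 / 2 - u) := mul_nonneg (by positivity) (by linarith)
  have a3 : 0 ≤ u * (1 / 2 - u) := mul_nonneg h0 (by linarith)
  have a4 : 0 ≤ u ^ 5 := by positivity
  nlinarith

/-- The bound on the sum of two squared sincs, cleared of denominators. At `x = 1/2` that sum is
`8/π² > 0.81`, which leaves room for polynomial estimates. Both sides are symmetric under `x ↦ 1 -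
x`, hence the variable `u = (2x - 1)²`. -/
theorem sin_pi_mul_sq_ge {x : ℝ} (h0 : 0 < x) (h1 : x < 1) :
    3 / 4 * (Real.pi ^ 2 * (x ^ 2 * (1 - x) ^ 2)) ≤
      Real.sin (Real.pi * x) ^ 2 * (x ^ 2 + (1 - x) ^ 2) := by
  have hpi := Real.pi_gt_three
  have hpi' := Real.pi_lt_d2
  have hpi2 : Real.pi ^ 2 ≤ 987 / 100 := by nlinarith [Real.pi_lt_d4, Real.pi_pos]
  set u := (2 * x - 1) ^ 2 with hu
  have hu0 : 0 ≤ u := sq_nonneg _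
  have hu1 : u < 1 := by nlinarith
  have e1 : x * (1 - x) = (1 - u) / 4 := by rw [hu]; ring
  have e2 : x ^ 2 + (1 - x) ^ 2 = (1 + u) / 2 := by rw [hu]; ring
  have e3 : x ^ 2 * (1 - x) ^ 2 = ((1 - u) / 4) ^ 2 := by rw [← e1]; ring
  rw [e2, e3]
  rcases le_total u (1 / 2) with h | h
  · have hy : (Real.pi * (x - 1 / 2)) ^ 2 = Real.pi ^ 2 * u / 4 := by rw [hu]; ring
    have hs : Real.sin (Real.pi * x) = Real.cos (Real.pi * (x - 1 / 2)) := by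
      rw [← Real.cos_sub_pi_div_two]; ring_nf
    -- Bounding the cosine of the half angle by its quadratic Taylor polynomial and doubling is
    -- sharper than the direct quadratic bound. The constant `0.3085` below exceeds `π² / 32`.
    have h2 : Real.cos (Real.pi * (x - 1 / 2)) =
        2 * Real.cos (Real.pi * (x - 1 / 2) / 2) ^ 2 - 1 := by
      rw [← Real.cos_two_mul]; ring_nf
    have h3 := Real.one_sub_sq_div_two_le_cos (x := Real.pi * (x - 1 / 2) / 2)
    rw [div_pow, hy] at h3
    have h4 : 1 - 3085 / 10000 * u ≤ Real.cos (Real.pi * (x - 1 / 2) / 2) := by nlinarith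
    have h5 : 1 - 1234 / 1000 * u + 19 / 100 * u ^ 2 ≤ Real.sin (Real.pi * x) := by
      have : (1 - 3085 / 10000 * u) ^ 2 ≤ Real.cos (Real.pi * (x - 1 / 2) / 2) ^ 2 := by
        have : 0 ≤ 1 - 3085 / 10000 * u := by linarith
        gcongr
      rw [hs, h2]; nlinarith
    have h6 : (1 - 1234 / 1000 * u + 19 / 100 * u ^ 2) ^ 2 ≤ Real.sin (Real.pi * x) ^ 2 := by
      have : 0 ≤ 1 - 1234 / 1000 * u + 19 / 100 * u ^ 2 := by nlinarith
      gcongr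
    have h7 := quartic_sq_ge hu0 h
    have h8 := mul_le_mul_of_nonneg_right h6 (by linarith : 0 ≤ 1 + u)
    nlinarith [mul_le_mul_of_nonneg_right hpi2 (sq_nonneg (1 - u))]
  -- Away from the middle the factor `(1 + u) / 2` is already at least `3/4`, so the parabola `π x
  -- (1 - x)` is a good enough lower bound for the sine.
  · have hs : Real.pi * ((1 - u) / 4) ≤ Real.sin (Real.pi * x) := by
      rw [← e1]
      rcases le_total x (1 / 2) with hx | hx
      · exact pi_mul_le_sin h0 hx
      · have := pi_mul_le_sin (x := 1 - x) (by linarith) (by linarith)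
        rw [show Real.pi * (1 - x) = Real.pi - Real.pi * x by ring, Real.sin_pi_sub] at this
        linarith
    have hq : (Real.pi * ((1 - u) / 4)) ^ 2 ≤ Real.sin (Real.pi * x) ^ 2 := by
      have : 0 ≤ 1 - u := by linarith
      gcongr
    calc _ = (Real.pi * ((1 - u) / 4)) ^ 2 * (3 / 4) := by ring
      _ ≤ _ := mul_le_mul hq (by linarith) (by norm_num) (sq_nonneg _)

/-- The normalized exponential sum of phase estimation. -/
noncomputable def phaseKernel (N : ℕ) (u : ℝ) : ℝ :=
  ‖∑ j ∈ Finset.range N, Complex.exp (2 * Real.pi * Complex.I * j * u) / N‖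

theorem phaseKernel_add_int (N : ℕ) (u : ℝ) (z : ℤ) :
    phaseKernel N (u + z) = phaseKernel N u := by
  unfold phaseKernel
  congr 1
  refine Finset.sum_congr rfl fun j _ => ?_
  congr 1
  have := Complex.exp_periodic.int_mul (j * z) (2 * Real.pi * Complex.I * j * u)
  rw [← this]
  congr 1
  push_cast
  ring

/-- Summing the geometric series gives `N · phaseKernel N u · |sin (πu)| = |sin (πNu)|`, and `|sin
(πu)| ≤ π|u|`. -/
theorem sinc_le_phaseKernel {N : ℕ} (hN : 2 ≤ N) {u : ℝ} (hu : |u| ≤ 1 / N) :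
    Real.sinc (Real.pi * N * u) ≤ phaseKernel N u := by
  have hN0 : (0 : ℝ) < N := by positivity
  rcases eq_or_ne u 0 with rfl | hu0
  · simp [phaseKernel, hN0.ne']
  have hpi := Real.pi_pos
  have h2 : (1 : ℝ) / N ≤ 1 / 2 := by
    gcongr; exact_mod_cast hN
  set z := Complex.exp (2 * Real.pi * Complex.I * u) with hz
  have hn : ∀ v : ℝ, ‖Complex.exp (2 * Real.pi * Complex.I * v) - 1‖ = 2 * |Real.sin (Real.pi * v)| := by
    intro v
    have h := Complex.norm_exp_I_mul_ofReal_sub_one (2 * Real.pi * v)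
    rw [show Complex.I * (2 * Real.pi * v : ℝ) = 2 * Real.pi * Complex.I * v by push_cast; ring,
      show 2 * Real.pi * v / 2 = Real.pi * v by ring] at h
    rw [h, Real.norm_eq_abs, abs_mul, abs_two]
  have hpow : ∀ j : ℕ, Complex.exp (2 * Real.pi * Complex.I * j * u) = z ^ j := by
    intro j
    rw [hz, ← Complex.exp_nat_mul]
    congr 1; ring
  have hsum : phaseKernel N u * N * (2 * |Real.sin (Real.pi * u)|) =
      2 * |Real.sin (Real.pi * N * u)| := by
    have h := geom_sum_mul z N
    rw [← hpow] at h
    have h' := congrArg norm h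
    have e := hn (N * u)
    push_cast at e
    rw [norm_mul, hn u, show 2 * (Real.pi : ℂ) * Complex.I * N * u = 2 * Real.pi * Complex.I * (N * u) by ring,
      e] at h'
    rw [phaseKernel, ← Finset.sum_div, norm_div, Complex.norm_natCast, div_mul_cancel₀ _ hN0.ne']
    simp only [hpow]
    rw [h', mul_assoc]
  have hs1 : |Real.sin (Real.pi * u)| ≤ |Real.pi * u| := Real.abs_sin_le_abs
  have hx : |Real.pi * N * u| ≤ Real.pi := by
    rw [mul_assoc, abs_mul, abs_mul, abs_of_pos hpi, abs_of_pos hN0]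
    have : N * |u| ≤ 1 := by
      rw [← mul_one_div_cancel hN0.ne']; gcongr
    nlinarith
  have hne : Real.pi * N * u ≠ 0 := by positivity
  rw [Real.sinc_of_ne_zero hne]
  have hs : Real.sin (Real.pi * N * u) / (Real.pi * N * u)
      ≤ |Real.sin (Real.pi * N * u)| / |Real.pi * N * u| := by
    rw [← abs_div]; exact le_abs_self _
  refine hs.trans ?_
  rw [div_le_iff₀ (by positivity)]
  have hk : 0 ≤ phaseKernel N u := norm_nonneg _
  have : |Real.pi * N * u| = N * |Real.pi * u| := by
    rw [show Real.pi * N * u = N * (Real.pi * u) by ring, abs_mul, abs_of_pos hN0]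
  rw [this]
  nlinarith [mul_le_mul_of_nonneg_left hs1 (mul_nonneg hk hN0.le)]


theorem three_quarters_le_sinc_sq {x : ℝ} (h0 : 0 ≤ x) (h1 : x < 1) :
    3 / 4 ≤ Real.sinc (Real.pi * x) ^ 2 + Real.sinc (Real.pi * (x - 1)) ^ 2 := by
  have hpi := Real.pi_pos
  rcases h0.eq_or_lt with rfl | h0
  · simp; nlinarith [sq_nonneg (Real.sinc Real.pi)]
  have hx : 0 < 1 - x := by linarith
  have hs : Real.sin (Real.pi * (x - 1)) = -Real.sin (Real.pi * x) := by
    rw [show Real.pi * (x - 1) = Real.pi * x - Real.pi by ring, Real.sin_sub_pi]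
  rw [Real.sinc_of_ne_zero (by positivity),
    Real.sinc_of_ne_zero (mul_ne_zero hpi.ne' (by linarith)), hs]
  have e : (Real.sin (Real.pi * x) / (Real.pi * x)) ^ 2 +
      (-Real.sin (Real.pi * x) / (Real.pi * (x - 1))) ^ 2 =
      Real.sin (Real.pi * x) ^ 2 * (x ^ 2 + (1 - x) ^ 2) /
        (Real.pi ^ 2 * (x ^ 2 * (1 - x) ^ 2)) := by
    have : x - 1 ≠ 0 := by linarith
    field_simp
    ring
  rw [e, le_div_iff₀ (by positivity)]
  exact sin_pi_mul_sq_ge h0 h1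

/-- The outcomes nearest to the phase have total probability at least `3 / 4`. -/
theorem three_quarters_le_sum_phaseKernel {N : ℕ} (hN : 2 ≤ N) (x : ℝ) (p : ℕ → Prop)
    [DecidablePred p] (hp : ∀ n < N, ∀ z : ℤ, |x - n / N - z| ≤ 1 / N → p n) :
    3 / 4 ≤ ∑ n ∈ Finset.range N, if p n then phaseKernel N (x - n / N) ^ 2 else 0 := by
  have hN0 : (0 : ℝ) < N := by positivity
  have hNz : (0 : ℤ) < N := by positivity
  -- The grid point `l` may lie outside `[0, N)`. Reducing it modulo `N` shifts the argument of the
  -- 1-periodic kernel by the integer `l / N`.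
  have key : ∀ (l : ℤ), |x * N - l| ≤ 1 → p (l % N).toNat ∧ (l % N).toNat < N ∧
      Real.sinc (Real.pi * (x * N - l)) ≤
        phaseKernel N (x - ((l % N).toNat : ℕ) / N) := by
    intro l hl
    have hm := Int.emod_nonneg l hNz.ne'
    have hm' := Int.emod_lt_of_pos l hNz
    have hc : (((l % N).toNat : ℕ) : ℝ) = l - N * (l / N : ℤ) := by
      have h1 : (((l % N).toNat : ℕ) : ℤ) = l - N * (l / N) := by
        rw [Int.toNat_of_nonneg hm, Int.emod_def]
      exact_mod_cast h1
    have hd : x - (((l % N).toNat : ℕ) : ℝ) / N = (x * N - l) / N + (l / N : ℤ) := by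
      rw [hc]; field_simp; ring
    have ha : |(x * N - l) / N| ≤ 1 / N := by
      rw [abs_div, abs_of_pos hN0]; gcongr
    refine ⟨hp _ (by omega) (l / N) ?_, by omega, ?_⟩
    · rw [hd]; simpa using ha
    · rw [hd, phaseKernel_add_int]
      have := sinc_le_phaseKernel hN ha
      rwa [mul_assoc, mul_div_cancel₀ _ hN0.ne'] at this
  set l := ⌊x * N⌋
  have hl0 : 0 ≤ x * N - l := sub_nonneg.2 (Int.floor_le _)
  have hl1 : x * N - l < 1 := by linarith [Int.lt_floor_add_one (x * N)]
  obtain ⟨a1, a2, a3⟩ := key l (abs_le.2 ⟨by linarith, hl1.le⟩)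
  obtain ⟨b1, b2, b3⟩ := key (l + 1) (by push_cast; exact abs_le.2 ⟨by linarith, by linarith⟩)
  -- The two neighbours are different outcomes because `N ≥ 2`; otherwise their masses could not be
  -- added.
  have hne : (l % N).toNat ≠ ((l + 1) % N).toNat := by
    have h0 := Int.emod_nonneg l hNz.ne'
    have h1 := Int.emod_nonneg (l + 1) hNz.ne'
    intro h
    have h3 : l % N = (l + 1) % N := by omega
    have h4 : (N : ℤ) ∣ l + 1 - l := Int.ModEq.dvd h3
    rw [add_sub_cancel_left] at h4
    have := Int.le_of_dvd one_pos h4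
    omega
  have hx := three_quarters_le_sinc_sq hl0 hl1
  -- The lower bounds `a3` and `b3` are squared below, so they must be nonnegative.
  have c0 : 0 ≤ Real.sinc (Real.pi * (x * N - l)) := by
    rw [Real.sinc_apply]; split_ifs
    · exact zero_le_one
    · exact div_nonneg (Real.sin_nonneg_of_nonneg_of_le_pi (by positivity)
        (by nlinarith [Real.pi_pos])) (by positivity)
  have c1 : 0 ≤ Real.sinc (Real.pi * (x * N - l - 1)) := by
    have := Real.pi_pos
    rw [← Real.sinc_neg, Real.sinc_apply]; split_ifs
    · exact zero_le_one
    · exact div_nonneg (Real.sin_nonneg_of_nonneg_of_le_pi (by nlinarith) (by nlinarith))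
        (by nlinarith)
  push_cast at b3
  rw [← sub_sub] at b3
  calc _ ≤ _ := hx
    _ ≤ phaseKernel N (x - ((l % N).toNat : ℕ) / N) ^ 2 +
        phaseKernel N (x - (((l + 1) % N).toNat : ℕ) / N) ^ 2 := by gcongr
    _ = ∑ n ∈ {(l % N).toNat, ((l + 1) % N).toNat},
        if p n then phaseKernel N (x - n / N) ^ 2 else 0 := by
      rw [Finset.sum_pair hne, if_pos a1, if_pos b1]
    _ ≤ _ := by
      refine Finset.sum_le_sum_of_subset_of_nonneg ?_ fun _ _ _ => by positivity
      intro n hn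
      simp only [Finset.mem_insert, Finset.mem_singleton] at hn
      rcases hn with rfl | rfl <;> simpa

/-! ### The state preparation: unitarity and the good amplitude -/

theorem controlled_apply {ι : Type*} [DecidableEq ι] (c : Bool) (U : Matrix ι ι ℂ)
    (x y : Bool × ι) : controlled c U x y =
      if x.1 = y.1 then (if x.1 = c then U x.2 y.2 else (1 : Matrix ι ι ℂ) x.2 y.2) else 0 := by
  obtain ⟨b, i⟩ := x
  obtain ⟨b', i'⟩ := y
  cases b <;> cases b' <;> cases c <;> simp [controlled, proj]

theorem hadamard_mem_unitaryGroup : hadamard ∈ Matrix.unitaryGroup Bool ℂ := by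
  have h : ((Real.sqrt 2 : ℝ) : ℂ) * (Real.sqrt 2 : ℝ) = 2 := by
    norm_cast
    exact Real.mul_self_sqrt (by norm_num)
  have h0 : ((Real.sqrt 2 : ℝ) : ℂ) ≠ 0 := by
    intro h'; rw [h'] at h; norm_num at h
  rw [Matrix.mem_unitaryGroup_iff]
  ext i j
  cases i <;> cases j <;>
    simp [hadamard, Matrix.mul_apply, Matrix.star_apply] <;>
    field_simp <;> rw [pow_two, h] <;> norm_num

theorem flip_conjTranspose {q : ℕ} (k : Bits q) : (flip k)ᴴ = flip k := by
  ext i j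
  have : (j = fun l => xor (i l) (k l)) ↔ (i = fun l => xor (j l) (k l)) := by
    constructor <;> rintro rfl <;> simp
  simp only [flip, Matrix.conjTranspose_apply, Matrix.of_apply, this]
  split_ifs <;> simp

theorem flip_mul_flip {q : ℕ} (k : Bits q) : flip k * flip k = 1 := by
  ext i j
  rw [Matrix.mul_apply, Finset.sum_eq_single fun l => xor (i l) (k l)]
  · have : ((fun l => xor (i l) (k l)) = fun l => xor (j l) (k l)) ↔ i = j := by
      simp [funext_iff]
    simp [flip, Matrix.one_apply, this]
  · intro b _ hb
    have : ¬ i = fun l => xor (b l) (k l) := by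
      rintro rfl; simp at hb
    simp [flip, this]
  · simp

theorem flip_mem_unitaryGroup {q : ℕ} (k : Bits q) :
    flip k ∈ Matrix.unitaryGroup (Bits q) ℂ := by
  rw [Matrix.mem_unitaryGroup_iff, Matrix.star_eq_conjTranspose, flip_conjTranspose, flip_mul_flip]

theorem controlled_conjTranspose {ι : Type*} [DecidableEq ι] (c : Bool) (U : Matrix ι ι ℂ) :
    (controlled c U)ᴴ = controlled c Uᴴ := by
  ext x y
  simp only [Matrix.conjTranspose_apply, controlled_apply]
  by_cases h : x.1 = y.1
  · by_cases hc : x.1 = c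
    · simp [h, h ▸ hc]
    · have : y.1 ≠ c := h ▸ hc
      simp [h, this, Matrix.one_apply, eq_comm, apply_ite]
  · simp [h, Ne.symm h]

theorem controlled_mul {ι : Type*} [Fintype ι] [DecidableEq ι] (c : Bool) (U V : Matrix ι ι ℂ) :
    controlled c U * controlled c V = controlled c (U * V) := by
  have h1 : ∀ b b' : Bool, proj b * proj b' = if b = b' then proj b else 0 := by
    intro b b'
    by_cases h : b = b' <;> simp [proj, h]
  cases c <;> simp [controlled, add_mul, mul_add, ← Matrix.mul_kronecker_mul, h1]

theorem controlled_one {ι : Type*} [DecidableEq ι] (c : Bool) :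
    controlled c (1 : Matrix ι ι ℂ) = 1 := by
  ext x y
  by_cases h : x.1 = y.1 <;> simp [controlled_apply, Matrix.one_apply, Prod.ext_iff, h]

theorem controlled_mem_unitaryGroup {ι : Type*} [Fintype ι] [DecidableEq ι] (c : Bool)
    {U : Matrix ι ι ℂ} (hU : U ∈ Matrix.unitaryGroup ι ℂ) :
    controlled c U ∈ Matrix.unitaryGroup (Bool × ι) ℂ := by
  rw [Matrix.mem_unitaryGroup_iff, Matrix.star_eq_conjTranspose] at *
  rw [controlled_conjTranspose, controlled_mul, hU, controlled_one]

theorem prep_mem_unitaryGroup {q : ℕ} {V : Matrix (Bits q) (Bits q) ℂ}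
    (hV : V ∈ Matrix.unitaryGroup (Bits q) ℂ) (k : Bits q) :
    prep V k ∈ Matrix.unitaryGroup (Bool × Bits q) ℂ := by
  have hH : hadamard ⊗ₖ (1 : Matrix (Bits q) (Bits q) ℂ) ∈
      Matrix.unitaryGroup (Bool × Bits q) ℂ :=
    Matrix.kronecker_mem_unitary hadamard_mem_unitaryGroup (one_mem _)
  exact mul_mem (mul_mem (mul_mem hH (controlled_mem_unitaryGroup _ (flip_mem_unitaryGroup k)))
    (controlled_mem_unitaryGroup _ hV)) hH

theorem smul_mem_unitaryGroup {ι : Type*} [Fintype ι] [DecidableEq ι] {U : Matrix ι ι ℂ}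
    (hU : U ∈ Matrix.unitaryGroup ι ℂ) (γ : ℝ) :
    Complex.exp (-(γ * Complex.I)) • U ∈ Matrix.unitaryGroup ι ℂ := by
  have h : Complex.exp (-(γ * Complex.I)) * star (Complex.exp (-(γ * Complex.I))) = 1 := by
    rw [Complex.star_def, ← Complex.exp_conj, ← Complex.exp_add]
    simp
  rw [Matrix.mem_unitaryGroup_iff] at *
  rw [star_smul, Matrix.smul_mul, Matrix.mul_smul, smul_smul, hU, h, one_smul]

theorem hadamard_kronecker_one_apply {ι : Type*} [DecidableEq ι] (x y : Bool × ι) :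
    (hadamard ⊗ₖ (1 : Matrix ι ι ℂ)) x y = if x.2 = y.2 then hadamard x.1 y.1 else 0 := by
  by_cases h : x.2 = y.2 <;> simp [Matrix.kroneckerMap_apply, Matrix.one_apply, h]

/-- The amplitude of the good state is `(1 + α k) / 2`. -/
theorem prep_good {q : ℕ} (V : Matrix (Bits q) (Bits q) ℂ) (k : Bits q) :
    prep V k (false, k) (false, zeros q) = (1 + V k (zeros q)) / 2 := by
  have h : ((Real.sqrt 2 : ℝ) : ℂ) * (Real.sqrt 2 : ℝ) = 2 := by
    norm_cast
    exact Real.mul_self_sqrt (by norm_num)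
  have hf : ∀ d : Bits q, flip k k d = if d = zeros q then 1 else 0 := by
    intro d
    have : (k = fun l => xor (d l) (k l)) ↔ d = zeros q := by
      simp only [funext_iff, zeros]
      refine forall_congr' fun x => ?_
      cases d x <;> cases k x <;> simp
    simp [flip, this]
  -- The entry is the product of a row of the left two factors and a column of the right two. On the
  -- branch `0` the flip carries `zeros q` to `k` and contributes `1`; on the branch `1` the oracle
  -- contributes its entry.
  have h1 : ∀ y : Bool × Bits q,
      ((hadamard ⊗ₖ (1 : Matrix (Bits q) (Bits q) ℂ)) * controlled false (flip k)) (false, k) y =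
        1 / (Real.sqrt 2 : ℝ) * if y.2 = (if y.1 then k else zeros q) then 1 else 0 := by
    rintro ⟨b, d⟩
    cases b <;> simp [Matrix.mul_apply, Fintype.sum_prod_type, controlled_apply, hadamard, hf,
      Matrix.one_apply, @eq_comm _ k]
  have h2 : ∀ y : Bool × Bits q,
      (controlled true V * (hadamard ⊗ₖ (1 : Matrix (Bits q) (Bits q) ℂ))) y (false, zeros q) =
        1 / (Real.sqrt 2 : ℝ) *
          if y.1 then V y.2 (zeros q) else if y.2 = zeros q then 1 else 0 := by
    rintro ⟨b, d⟩
    cases b <;> simp [Matrix.mul_apply, Fintype.sum_prod_type, controlled_apply, hadamard, Matrix.one_apply, mul_comm]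
  rw [prep, mul_assoc, Matrix.mul_apply, Fintype.sum_prod_type]
  simp only [h1, h2, Fintype.sum_bool]
  simp only [if_true, Bool.false_eq_true, if_false, mul_ite, mul_one, mul_zero, ite_mul, zero_mul,
    Finset.sum_ite_eq', Finset.mem_univ]
  have h0 : ((Real.sqrt 2 : ℝ) : ℂ) ≠ 0 := by
    intro h'; rw [h'] at h; norm_num at h
  field_simp
  rw [pow_two, h]
  ring

open scoped ComplexOrder in
-- The vector `b` is the component of `ψ` orthogonal to the good state, divided by `cos θ`; its
-- squared norm before division is `cos² θ`. If `cos θ = 0`, this component vanishes and any other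
-- basis vector serves, which is why `ι` has to be nontrivial.
theorem exists_rotation_plane {ι : Type*} [Fintype ι] [DecidableEq ι] [Nontrivial ι] (ψ : ι → ℂ)
    (hψ : star ψ ⬝ᵥ ψ = 1) (good : ι) (θ : ℝ) (hg : ψ good = Real.sin θ) :
    ∃ b : ι → ℂ, b good = 0 ∧ star b ⬝ᵥ b = 1 ∧
      ψ = (Real.sin θ : ℂ) • ket good + (Real.cos θ : ℂ) • b := by
  set r := ψ - (Real.sin θ : ℂ) • ket good with hr
  have hr0 : r good = 0 := by simp [hr, hg, ket]
  have hrr : star r ⬝ᵥ r = (Real.cos θ : ℂ) ^ 2 := by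
    have e : star ψ ⬝ᵥ ψ = star r ⬝ᵥ r + (Real.sin θ : ℂ) ^ 2 := by
      have hψr : ψ = r + (Real.sin θ : ℂ) • ket good := by rw [hr]; abel
      rw [hψr, star_add, star_smul, add_dotProduct, dotProduct_add, dotProduct_add]
      have : star (ket good) ⬝ᵥ r = 0 := by simp [ket, hr0]
      rw [smul_dotProduct, this]
      simp [ket, hr0, pow_two, -Complex.ofReal_sin]
    have h1 : (Real.sin θ : ℂ) ^ 2 + (Real.cos θ : ℂ) ^ 2 = 1 := by
      exact_mod_cast Real.sin_sq_add_cos_sq θ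
    rw [hψ] at e
    linear_combination -e - h1
  by_cases hc : Real.cos θ = 0
  · obtain ⟨y, hy⟩ := exists_ne good
    refine ⟨ket y, by simp [ket, hy.symm], by simp [ket], ?_⟩
    have : r = 0 := by
      rw [hc] at hrr
      exact dotProduct_star_self_eq_zero.1 (by simpa [dotProduct_comm] using hrr)
    rw [hc]
    simpa [hr, sub_eq_zero] using this
  · have hc' : (Real.cos θ : ℂ) ≠ 0 := by exact_mod_cast hc
    refine ⟨(Real.cos θ : ℂ)⁻¹ • r, by simp [hr0], ?_, ?_⟩
    · rw [star_smul, smul_dotProduct, dotProduct_smul, hrr]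
      simp only [star_inv₀, Complex.star_def, Complex.conj_ofReal, smul_eq_mul]
      field_simp
    · rw [smul_smul, mul_inv_cancel₀ hc', one_smul, hr]; abel

/-- The outcome distribution of amplitude estimation of an amplitude `sin θ`. -/
theorem ampEst_prob {ι : Type*} [Fintype ι] [DecidableEq ι] [Nontrivial ι] (t : ℕ)
    {A : Matrix ι ι ℂ} (hA : A ∈ Matrix.unitaryGroup ι ℂ) (zero good : ι) (θ : ℝ)
    (hθ : A good zero = Real.sin θ) (a : Bits t) :
    ∑ y, ‖ampEstState t A zero good (a, y)‖ ^ 2 =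
      (phaseKernel (2 ^ t) (θ / Real.pi - val a / (2 ^ t : ℕ)) ^ 2 +
        phaseKernel (2 ^ t) (-(θ / Real.pi) - val a / (2 ^ t : ℕ)) ^ 2) / 2 := by
  have hψ : star (A *ᵥ ket zero) ⬝ᵥ (A *ᵥ ket zero) = 1 := by
    have h : Aᴴ * A = 1 := Matrix.mem_unitaryGroup_iff'.1 hA
    rw [Matrix.star_mulVec, Matrix.dotProduct_mulVec, Matrix.vecMul_vecMul, h]
    simp [ket]
  obtain ⟨b, hb, hb1, hA'⟩ := exists_rotation_plane _ hψ good θ (by rw [mulVec_ket]; exact hθ)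
  simp only [ampEstState_apply, grover_pow_mulVec hA zero good θ b hb hb1 hA']
  rw [rotation_fourier_normSq _ _ (fun j : Bits t => (2 * val j + 1) * θ) good b hb hb1]
  have hpi := Real.pi_pos
  -- Of the angle `(2j + 1) x`, the part `x` is a global phase and `2jx` is the frequency `x / π`.
  -- This is used for `x = θ` and `x = -θ`.
  have key : ∀ x : ℝ, ‖∑ j : Bits t, Complex.exp (-(2 * Real.pi * Complex.I *
      (val j * val a : ℕ) / (2 ^ t : ℕ))) / (2 ^ t : ℕ) *
      Complex.exp (((2 * val j + 1) * x : ℝ) * Complex.I)‖ =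
      phaseKernel (2 ^ t) (x / Real.pi - val a / (2 ^ t : ℕ)) := by
    intro x
    have e : ∀ j : Bits t, Complex.exp (-(2 * Real.pi * Complex.I *
      (val j * val a : ℕ) / (2 ^ t : ℕ))) / (2 ^ t : ℕ) *
      Complex.exp (((2 * val j + 1) * x : ℝ) * Complex.I) = Complex.exp (x * Complex.I) *
      (Complex.exp (2 * Real.pi * Complex.I * val j *
        (x / Real.pi - val a / (2 ^ t : ℕ) : ℝ)) / (2 ^ t : ℕ)) := by
      intro j
      rw [div_mul_eq_mul_div, ← Complex.exp_add, ← mul_div_assoc, ← Complex.exp_add]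
      congr 2
      have : (Real.pi : ℂ) ≠ 0 := by exact_mod_cast hpi.ne'
      push_cast
      field_simp
      ring
    simp only [e]
    rw [← Finset.mul_sum, norm_mul, Complex.norm_exp_ofReal_mul_I, one_mul, phaseKernel,
      sum_val t fun n => Complex.exp (2 * Real.pi * Complex.I * n *
        (x / Real.pi - val a / (2 ^ t : ℕ) : ℝ)) / (2 ^ t : ℕ)]
  have k2 := key (-θ)
  rw [neg_div] at k2
  rw [← key θ, ← k2]
  congr 6 with j
  push_cast
  congr 3
  ring

/-! ### Folding the phase register to the distance from the integers -/

/-- The estimate of the phase in `[0, 1 / 2]` when the phase register reads `x`. -/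
noncomputable def foldPhase (x : ℝ) : ℝ := if x < 1 / 2 then x else 1 - x

/-- Together with `exists_foldPhase_eq` this identifies `foldPhase` on `[0, 1)` with the distance to
the nearest integer. -/
theorem foldPhase_le {x : ℝ} (h0 : 0 ≤ x) (h1 : x < 1) (z : ℤ) : foldPhase x ≤ |x - z| := by
  have hz : (z : ℝ) ≤ 0 ∨ (1 : ℝ) ≤ z := by
    rcases le_or_gt z 0 with h | h
    · left; exact_mod_cast h
    · right; exact_mod_cast h
  unfold foldPhase
  rcases hz with hz | hz
  · rw [abs_of_nonneg (by linarith)]; split_ifs <;> linarith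
  · rw [abs_of_nonpos (by linarith)]; split_ifs <;> linarith

theorem exists_foldPhase_eq {x : ℝ} (h0 : 0 ≤ x) (h1 : x < 1) :
    ∃ z : ℤ, foldPhase x = |x - z| := by
  unfold foldPhase
  split_ifs
  · exact ⟨0, by simp [abs_of_nonneg h0]⟩
  · exact ⟨1, by push_cast; rw [abs_of_nonpos (by linarith)]; ring⟩

/-- The distance to the integers is 1-Lipschitz and 1-periodic, and `φ ∈ [0, 1/2]` is its own
distance to the integers. -/
theorem abs_foldPhase_sub_le {x φ δ : ℝ} (h0 : 0 ≤ x) (h1 : x < 1) (hφ0 : 0 ≤ φ) (hφ1 : φ ≤ 1 / 2)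
    (z : ℤ) (h : |φ - x - z| ≤ δ) : |foldPhase x - φ| ≤ δ := by
  have hφ : ∀ w : ℤ, φ ≤ |φ - w| := by
    intro w
    rcases le_or_gt w 0 with hw | hw
    · have : (w : ℝ) ≤ 0 := by exact_mod_cast hw
      linarith [le_abs_self (φ - w)]
    · have : (1 : ℝ) ≤ w := by exact_mod_cast hw
      linarith [neg_abs_le (φ - w)]
  have hx := foldPhase_le h0 h1
  obtain ⟨w, hw⟩ := exists_foldPhase_eq h0 h1
  rw [abs_le]
  constructor
  · have h2 := hφ (w + z)
    have h3 : |φ - (w + z : ℤ)| ≤ |φ - x - z| + |x - w| := by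
      have e : φ - (w + z : ℤ) = (φ - x - z) + (x - w) := by push_cast; ring
      rw [e]
      exact abs_add_le _ _
    linarith
  · have h2 := hx (-z)
    have h3 : |x - (-z : ℤ)| ≤ |φ - x - z| + |φ| := by
      have e : x - (-z : ℤ) = φ - (φ - x - z) := by push_cast; ring
      rw [e, add_comm]
      exact abs_sub _ _
    rw [abs_of_nonneg hφ0] at h3
    linarith

/-- The case of the eigenphase `-φ`: folding is invariant under `x ↦ 1 - x`. The point `x = 0` is
separate, since its mirror image `1` leaves `[0, 1)`. -/
theorem abs_foldPhase_sub_le' {x φ δ : ℝ} (h0 : 0 ≤ x) (h1 : x < 1) (hφ0 : 0 ≤ φ)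
    (hφ1 : φ ≤ 1 / 2) (z : ℤ) (h : |-φ - x - z| ≤ δ) : |foldPhase x - φ| ≤ δ := by
  rcases h0.eq_or_lt with rfl | h0
  · refine abs_foldPhase_sub_le le_rfl h1 hφ0 hφ1 (-z) ?_
    rw [← abs_neg]
    convert h using 2
    push_cast; ring
  · have e : |foldPhase x - φ| = |foldPhase (1 - x) - φ| := by
      have : foldPhase (1 - x) = foldPhase x := by
        unfold foldPhase
        split_ifs <;> linarith
      rw [this]
    rw [e]
    refine abs_foldPhase_sub_le (by linarith) (by linarith) hφ0 hφ1 (-z - 1) ?_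
    rw [← abs_neg]
    convert h using 2
    push_cast; ring

/-! ### The decision threshold and the success probability -/

theorem returnValue_eq {t : ℕ} (ε : ℝ) (a : Bits t) : returnValue ε a =
    decide (foldPhase (frac a) > 1 / 6 - 2 * ε / (3 * Real.sqrt 3 * Real.pi)) := by
  unfold returnValue foldPhase
  split_ifs <;> rfl

/-- The ceiling gives resolution `ε / (9√3π)`, and the two extra qubits divide it by four.
Truncating a negative ceiling to `0` only improves the resolution. -/
theorem inv_two_pow_accuracy_le {ε : ℝ} (hε : 0 < ε) :
    1 / ((2 ^ accuracy ε : ℕ) : ℝ) ≤ ε / (36 * Real.sqrt 3 * Real.pi) := by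
  have hpi := Real.pi_pos
  have hx : 0 < 9 * Real.sqrt 3 * Real.pi / ε := by positivity
  have h : 9 * Real.sqrt 3 * Real.pi / ε ≤ 2 ^ ⌈Real.logb 2 (9 * Real.sqrt 3 * Real.pi / ε)⌉₊ := by
    rw [← Real.rpow_natCast, ← Real.logb_le_iff_le_rpow (by norm_num) hx]
    exact Nat.le_ceil _
  rw [accuracy, pow_add]
  push_cast
  rw [div_le_div_iff₀ (by positivity) (by positivity)]
  rw [div_le_iff₀ hε] at h
  nlinarith

/-- The decision threshold separates the two ranges of the amplitude. -/
theorem returnValue_of_near {t : ℕ} {ε α θ δ : ℝ} (a : Bits t) (hε : 0 < ε) (hα : -1 ≤ α)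
    (hα1 : α ≤ 1) (hθ : θ = Real.arcsin ((1 + α) / 2)) (hδ : δ ≤ ε / (36 * Real.sqrt 3 * Real.pi))
    (h : |foldPhase (frac a) - θ / Real.pi| ≤ δ) :
    (α ≤ -ε → returnValue ε a = false) ∧ (returnValue ε a = false → α ≤ 1 / 3 * ε) ∧
      (α > 1 / 3 * ε → returnValue ε a = true) ∧ (returnValue ε a = true → α > -ε) := by
  have hpi := Real.pi_gt_three
  have h3 : 1.7 ≤ Real.sqrt 3 := Real.le_sqrt_of_sq_le (by norm_num)
  have hs : 5.1 ≤ Real.sqrt 3 * Real.pi := by nlinarith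
  obtain ⟨hl, hu⟩ := abs_le.1 h
  set s := Real.sqrt 3 * Real.pi with hsdef
  have e1 : ε / (36 * Real.sqrt 3 * Real.pi) = ε / s / 36 := by
    rw [hsdef]; field_simp
  have e2 : 2 * ε / (3 * Real.sqrt 3 * Real.pi) = 2 / 3 * (ε / s) := by
    rw [hsdef]; field_simp
  have hes : ε / s ≤ ε / 5.1 := by gcongr
  have hes0 : 0 < ε / s := by positivity
  have hr1 : α ≤ -ε → returnValue ε a = false := by
    intro hαε
    -- Concavity of the sine between `0` and `π / 6`, with weights `-α` and `1 + α`: `(1 + α) / 2 ≤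
    -- sin ((1 + α) π / 6)`.
    have hθ' : θ ≤ Real.pi / 6 * (1 + α) := by
      rw [hθ, Real.arcsin_le_iff_le_sin ⟨by linarith, by linarith⟩ ⟨by nlinarith, by nlinarith⟩]
      have hc := strictConcaveOn_sin_Icc.concaveOn.2 (⟨le_rfl, by linarith⟩ : (0 : ℝ) ∈ Set.Icc 0 Real.pi)
        (⟨by linarith, by linarith⟩ : Real.pi / 6 ∈ Set.Icc 0 Real.pi) (by linarith : 0 ≤ -α)
        (by linarith : 0 ≤ 1 + α) (by ring)
      simp only [smul_eq_mul, Real.sin_zero, mul_zero, zero_add, Real.sin_pi_div_six] at hc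
      rw [mul_comm (Real.pi / 6)]
      linarith
    have : θ / Real.pi ≤ 1 / 6 * (1 + α) := by
      rw [div_le_iff₀ (by linarith)]; linarith
    -- With `s = √3 π ≥ 5.1`, the threshold offset and the estimation error add up to `(2/3 + 1/36)
    -- ε / s`, which is less than the gap `ε / 6`.
    rw [returnValue_eq, decide_eq_false_iff_not, e2]
    rw [e1] at hδ
    norm_num at hes
    linarith
  have hr2 : α > 1 / 3 * ε → returnValue ε a = true := by
    intro hαε
    -- Positivity of `α` is enough for this; the error `ε / (36 s)` is then far below the offset `2ε
    -- / (3s)`.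
    have hθ' : Real.pi / 6 ≤ θ := by
      rw [hθ, Real.le_arcsin_iff_sin_le ⟨by linarith, by linarith⟩ ⟨by linarith, by linarith⟩,
        Real.sin_pi_div_six]
      linarith
    have : 1 / 6 ≤ θ / Real.pi := by
      rw [le_div_iff₀ (by linarith)]; linarith
    rw [returnValue_eq, decide_eq_true_iff, e2]
    rw [e1] at hδ
    linarith
  -- The two remaining claims are the contrapositives of `hr2` and `hr1`.
  refine ⟨hr1, fun hf => ?_, hr2, fun ht => ?_⟩
  · by_contra hc
    rw [hr2 (not_le.1 hc)] at hf
    exact absurd hf (by simp)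
  · by_contra hc
    rw [hr1 (not_lt.1 hc)] at ht
    exact absurd ht (by simp)

/-- The routine answers correctly with probability at least `3 / 4`. -/
theorem three_quarters_le_probReturn {q : ℕ} {U : Matrix (Bits q) (Bits q) ℂ} {γ : ℝ}
    {α : Bits q → ℝ} {k : Bits q} {ε : ℝ} (hU : U ∈ Matrix.unitaryGroup (Bits q) ℂ)
    (hα : U *ᵥ ket (zeros q) = fun j => Complex.exp (γ * Complex.I) * (α j : ℂ)) (hε : 0 < ε) :
    3 / 4 ≤ probReturn (Complex.exp (-(γ * Complex.I)) • U) k ε (fun r =>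
        (α k ≤ -ε → r = false) ∧ (r = false → α k ≤ 1 / 3 * ε) ∧
        (α k > 1 / 3 * ε → r = true) ∧ (r = true → α k > -ε)) := by
  classical
  have hV := smul_mem_unitaryGroup hU γ
  set V := Complex.exp (-(γ * Complex.I)) • U with hVdef
  have hVk : V k (zeros q) = α k := by
    have := congrFun hα k
    rw [mulVec_ket] at this
    beta_reduce at this
    rw [hVdef, Matrix.smul_apply, smul_eq_mul, this, ← mul_assoc, ← Complex.exp_add]
    simp
  have hα1 : |α k| ≤ 1 := by
    have := entry_norm_bound_of_unitary hV k (zeros q)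
    rwa [hVk, Complex.norm_real, Real.norm_eq_abs] at this
  obtain ⟨ha, hb⟩ := abs_le.1 hα1
  set θ := Real.arcsin ((1 + α k) / 2) with hθ
  have hsin : prep V k (false, k) (false, zeros q) = Real.sin θ := by
    rw [prep_good, hVk, hθ, Real.sin_arcsin (by linarith) (by linarith)]
    push_cast; ring
  have hθ0 : 0 ≤ θ := Real.arcsin_nonneg.2 (by linarith)
  have hpi := Real.pi_pos
  have hφ0 : 0 ≤ θ / Real.pi := by positivity
  have hφ1 : θ / Real.pi ≤ 1 / 2 := by
    rw [div_le_iff₀ hpi]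
    linarith [Real.arcsin_le_pi_div_two ((1 + α k) / 2)]
  set N := 2 ^ accuracy ε with hN
  have hN2 : 2 ≤ N := by
    rw [hN, accuracy, pow_add]
    have := Nat.one_le_two_pow (n := ⌈Real.logb 2 (9 * Real.sqrt 3 * Real.pi / ε)⌉₊)
    omega
  have hN0 : (0 : ℝ) < N := by positivity
  have hδ := inv_two_pow_accuracy_le hε
  rw [← hN] at hδ
  -- The event that the folded outcome is within `1 / N` of `θ / π`. It has mass at least `3/4`
  -- under the distributions of both eigenphases, hence also under their mean.
  set p : ℕ → Prop := fun n => |foldPhase (n / N) - θ / Real.pi| ≤ 1 / N with hp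
  have hx : ∀ n < N, (0 : ℝ) ≤ n / N ∧ (n : ℝ) / N < 1 := by
    intro n hn
    refine ⟨by positivity, ?_⟩
    rw [div_lt_one hN0]
    exact_mod_cast hn
  have hp1 := three_quarters_le_sum_phaseKernel hN2 (θ / Real.pi) p fun n hn z hz =>
    abs_foldPhase_sub_le (hx n hn).1 (hx n hn).2 hφ0 hφ1 z hz
  have hp2 := three_quarters_le_sum_phaseKernel hN2 (-(θ / Real.pi)) p fun n hn z hz =>
    abs_foldPhase_sub_le' (hx n hn).1 (hx n hn).2 hφ0 hφ1 z hz
  have hpr : ∀ a : Bits (accuracy ε), ∑ y, ‖finalState V k ε (a, y)‖ ^ 2 =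
      (phaseKernel N (θ / Real.pi - val a / N) ^ 2 +
        phaseKernel N (-(θ / Real.pi) - val a / N) ^ 2) / 2 := by
    intro a
    exact ampEst_prob _ (prep_mem_unitaryGroup hV k) (false, zeros q) (false, k) θ hsin a
  have hsum := sum_val (accuracy ε) fun n => if p n then
    (phaseKernel N (θ / Real.pi - n / N) ^ 2 + phaseKernel N (-(θ / Real.pi) - n / N) ^ 2) / 2
    else 0
  calc (3 / 4 : ℝ) ≤ ∑ n ∈ Finset.range N, if p n then
      (phaseKernel N (θ / Real.pi - n / N) ^ 2 + phaseKernel N (-(θ / Real.pi) - n / N) ^ 2) / 2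
      else 0 := by
        have : ∀ n, (if p n then (phaseKernel N (θ / Real.pi - n / N) ^ 2 +
            phaseKernel N (-(θ / Real.pi) - n / N) ^ 2) / 2 else 0) =
            ((if p n then phaseKernel N (θ / Real.pi - n / N) ^ 2 else 0) +
            (if p n then phaseKernel N (-(θ / Real.pi) - n / N) ^ 2 else 0)) / 2 := by
          intro n; split_ifs <;> simp
        simp only [this]
        rw [← Finset.sum_div, Finset.sum_add_distrib]
        linarith
    _ = _ := hsum.symm
    _ ≤ _ := by
      unfold probReturn
      refine Finset.sum_le_sum fun a _ => ?_
      rw [hpr]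
      by_cases h : p (val a)
      · have hf : frac a = val a / N := by rw [frac_eq, hN]; push_cast; rfl
        rw [if_pos h, if_pos]
        exact returnValue_of_near a hε ha hb hθ hδ (by rw [hf]; exact h)
      · rw [if_neg h]
        split_ifs <;> positivity

/-! ## Gates -/

section Gates
variable {W : Type*} [DecidableEq W] {q : ℕ}

/-- The gate `u` on the wire `w`, controlled by `a` and `b`; a control equal to `w` is dropped. -/
def ctrlGate (u : Matrix.unitaryGroup Bool ℂ) (a b w : W) : BasicGate W where
  target := w
  controls := ({a, b} : Finset W).erase w
  card_controls := (Finset.card_erase_le).trans (Finset.card_le_two)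
  target_notMem := Finset.notMem_erase w _
  u := u

theorem ctrlGate_apply (u : Matrix.unitaryGroup Bool ℂ) (a b w : W) (ψ : (W → Bool) → ℂ)
    (x : W → Bool) : (ctrlGate u a b w).apply ψ x =
      if (a ≠ w → x a = true) ∧ (b ≠ w → x b = true) then
        ∑ c : Bool, (u : Matrix Bool Bool ℂ) (x w) c * ψ (Function.update x w c) else ψ x := by
  have : (∀ v ∈ (ctrlGate u a b w).controls, x v = true) ↔
      (a ≠ w → x a = true) ∧ (b ≠ w → x b = true) := by
    simp only [ctrlGate, Finset.mem_erase, Finset.mem_insert, Finset.mem_singleton]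
    constructor
    · intro h
      exact ⟨fun ha => h a ⟨ha, Or.inl rfl⟩, fun hb => h b ⟨hb, Or.inr rfl⟩⟩
    · rintro ⟨h1, h2⟩ v ⟨hv, rfl | rfl⟩
      exacts [h1 hv, h2 hv]
  simp only [BasicGate.apply, this]
  rfl

/-- The Pauli `X` gate. -/
def pauliX : Matrix.unitaryGroup Bool ℂ :=
  ⟨Matrix.of fun a b => if a = b then 0 else 1, by
    rw [Matrix.mem_unitaryGroup_iff]
    ext i j
    cases i <;> cases j <;> simp [Matrix.mul_apply, Matrix.star_apply]⟩

/-- The gate that multiplies `|1⟩` by `exp (i φ)`. -/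
noncomputable def phaseGate (φ : ℝ) : Matrix.unitaryGroup Bool ℂ :=
  ⟨Matrix.diagonal fun b => if b then Complex.exp (φ * Complex.I) else 1, by
    rw [Matrix.mem_unitaryGroup_iff, Matrix.star_eq_conjTranspose, Matrix.diagonal_conjTranspose,
      Matrix.diagonal_mul_diagonal, ← Matrix.diagonal_one]
    congr 1
    ext b
    cases b
    · simp
    · simp [← Complex.exp_conj, ← Complex.exp_add]⟩

/-- The Hadamard gate as a unitary. -/
noncomputable def hadamardGate : Matrix.unitaryGroup Bool ℂ :=
  ⟨hadamard, hadamard_mem_unitaryGroup⟩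

theorem phaseGate_apply (φ : ℝ) (a w : W) (ψ : (W → Bool) → ℂ) (x : W → Bool) :
    (ctrlGate (phaseGate φ) a a w).apply ψ x =
      (if x a = true ∧ x w = true then Complex.exp (φ * Complex.I) else 1) * ψ x := by
  rw [ctrlGate_apply]
  have h : ∑ c : Bool, (phaseGate φ : Matrix Bool Bool ℂ) (x w) c * ψ (Function.update x w c) =
      (if x w = true then Complex.exp (φ * Complex.I) else 1) * ψ x := by
    rw [Finset.sum_eq_single (x w) (fun c _ hc => by simp [phaseGate, hc.symm])
      (by simp)]
    simp [phaseGate]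
  rw [h]
  by_cases hw : a = w
  · subst hw; simp
  · cases ha : x a <;> simp [hw]

/-- The classical action of a controlled `X` gate, given by two controls and the target. -/
def tog (g : W × W × W) (x : W → Bool) : W → Bool :=
  if (g.1 ≠ g.2.2 → x g.1 = true) ∧ (g.2.1 ≠ g.2.2 → x g.2.1 = true) then
    Function.update x g.2.2 (!x g.2.2) else x

/-- A control that coincides with the target is dropped, so flipping the target never changes the
condition tested. -/
theorem tog_tog (g : W × W × W) (x : W → Bool) : tog g (tog g x) = x := by
  unfold tog
  split_ifs with h1 h2
  · simp
  · exfalso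
    apply h2
    exact ⟨fun h => by rw [Function.update_of_ne h]; exact h1.1 h,
      fun h => by rw [Function.update_of_ne h]; exact h1.2 h⟩
  · rfl

theorem tog_of_ne (g : W × W × W) (x : W → Bool) {v : W} (hv : v ≠ g.2.2) : tog g x v = x v := by
  unfold tog
  split_ifs
  · exact Function.update_of_ne hv _ _
  · rfl

theorem ctrlGate_pauliX_apply (g : W × W × W) (ψ : (W → Bool) → ℂ) :
    (ctrlGate pauliX g.1 g.2.1 g.2.2).apply ψ = fun x => ψ (tog g x) := by
  ext x
  rw [ctrlGate_apply, tog]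
  split_ifs
  · cases x g.2.2 <;> simp [pauliX]
  · rfl

/-- The classical action of a list of controlled `X` gates. -/
def fwd (L : List (W × W × W)) (x : W → Bool) : W → Bool := L.foldl (fun x g => tog g x) x

theorem fwd_append (L L' : List (W × W × W)) (x : W → Bool) :
    fwd (L ++ L') x = fwd L' (fwd L x) := by
  simp [fwd]

theorem fwd_reverse_fwd (L : List (W × W × W)) (x : W → Bool) : fwd L.reverse (fwd L x) = x := by
  induction L generalizing x with
  | nil => rfl
  | cons g L ih =>
    rw [List.reverse_cons, fwd_append]
    change tog g (fwd L.reverse (fwd L (tog g x))) = x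
    rw [ih, tog_tog]

/-- The action of a list of operations. -/
noncomputable def runOps (U V : Matrix (Bits q) (Bits q) ℂ) (l : List (Op q W))
    (ψ : (W → Bool) → ℂ) : (W → Bool) → ℂ := l.foldl (fun φ o => o.apply U V φ) ψ

theorem runOps_append (U V : Matrix (Bits q) (Bits q) ℂ) (l l' : List (Op q W))
    (ψ : (W → Bool) → ℂ) : runOps U V (l ++ l') ψ = runOps U V l' (runOps U V l ψ) := by
  simp [runOps]

theorem runOps_gate (U V : Matrix (Bits q) (Bits q) ℂ) (g : BasicGate W) (ψ : (W → Bool) → ℂ) :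
    runOps U V [.gate g] ψ = g.apply ψ := rfl

/-- A list of controlled `X` gates as operations. -/
def toggles (q : ℕ) (L : List (W × W × W)) : List (Op q W) :=
  L.map fun g => .gate (ctrlGate pauliX g.1 g.2.1 g.2.2)

/-- Gates act on amplitudes by precomposition, which reverses the order of the list; each toggle is
its own inverse. -/
theorem runOps_toggles (U V : Matrix (Bits q) (Bits q) ℂ) (L : List (W × W × W))
    (ψ : (W → Bool) → ℂ) : runOps U V (toggles q L) ψ = fun x => ψ (fwd L.reverse x) := by
  induction L generalizing ψ with
  | nil => rfl
  | cons g L ih =>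
    change runOps U V (toggles q L) ((ctrlGate pauliX g.1 g.2.1 g.2.2).apply ψ) = _
    rw [ih, ctrlGate_pauliX_apply, List.reverse_cons]
    ext x
    rw [fwd_append]
    rfl

/-- Computing a bit, changing the sign depending on it, and uncomputing it. -/
theorem runOps_phase_kick (U V : Matrix (Bits q) (Bits q) ℂ) (L : List (W × W × W)) (w : W)
    (ψ : (W → Bool) → ℂ) (x : W → Bool) :
    runOps U V (toggles q L ++ [.gate (ctrlGate (phaseGate Real.pi) w w w)] ++
      toggles q L.reverse) ψ x = (if fwd L x w = true then -1 else 1) * ψ x := by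
  rw [runOps_append, runOps_append, runOps_toggles, runOps_toggles, List.reverse_reverse]
  beta_reduce
  rw [runOps_gate, phaseGate_apply, fwd_reverse_fwd, Complex.exp_pi_mul_I]
  simp

/-- The gates that add the value of `g` on the wires `a` and `c` to the wire `d`. -/
def gadget (g : Bool → Bool → Bool) (a c d : W) : List (W × W × W) :=
  (if g false false then [(d, d, d)] else []) ++
  (if xor (g true false) (g false false) then [(a, a, d)] else []) ++
  (if xor (g false true) (g false false) then [(c, c, d)] else []) ++
  (if xor (xor (g true true) (g true false)) (xor (g false true) (g false false))
    then [(a, c, d)] else [])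

theorem length_gadget_le (g : Bool → Bool → Bool) (a c d : W) : (gadget g a c d).length ≤ 4 := by
  unfold gadget
  simp only [List.length_append]
  split_ifs <;> simp

/-- The disjunctions account for dropped controls, so that `X`, `CNOT` and Toffoli gates are covered
by one formula. -/
theorem fwd_ite (p : Bool) (a b d : W) (x : W → Bool) :
    fwd (if p then [(a, b, d)] else []) x =
      Function.update x d (xor (x d) (p && (a = d || x a) && (b = d || x b))) := by
  cases p
  · simp [fwd]
  · by_cases h1 : a = d <;> by_cases h2 : b = d <;> cases h3 : x a <;> cases h4 : x b <;>
      simp [fwd, tog, h1, h2, h3, h4]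

/-- A Boolean function of two bits is a polynomial over the field with two elements; the gadget has
one gate for each monomial `1`, `a`, `c`, `ac` with nonzero coefficient. -/
theorem fwd_gadget (g : Bool → Bool → Bool) {a c d : W} (ha : a ≠ d) (hc : c ≠ d)
    (x : W → Bool) :
    fwd (gadget g a c d) x = Function.update x d (xor (x d) (g (x a) (x c))) := by
  unfold gadget
  rw [fwd_append, fwd_append, fwd_append, fwd_ite _ _ _ _, fwd_ite _ _ _ _,
    fwd_ite _ _ _ _, fwd_ite _ _ _ _]
  ext v
  by_cases hv : v = d
  · subst hv
    simp only [Function.update_self, Function.update_of_ne ha, Function.update_of_ne hc, ha, hc,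
      decide_true, decide_false, Bool.true_or, Bool.false_or, Bool.and_true]
    cases x a <;> cases x c <;> cases x v <;> cases g false false <;> cases g false true <;>
      cases g true false <;> cases g true true <;> rfl
  · simp [Function.update_of_ne hv]

/-- A chain of gadgets: the wire `c (i + 1)` receives the value of `g i` on `w i` and `c i`. -/
def ladder (g : ℕ → Bool → Bool → Bool) (w c : ℕ → W) : ℕ → List (W × W × W)
  | 0 => []
  | n + 1 => ladder g w c n ++ gadget (g n) (w n) (c n) (c (n + 1))

/-- The value computed by a ladder. -/
def ladderVal (g : ℕ → Bool → Bool → Bool) (inp : ℕ → Bool) (v : Bool) : ℕ → Bool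
  | 0 => v
  | n + 1 => g n (inp n) (ladderVal g inp v n)

theorem length_ladder_le (g : ℕ → Bool → Bool → Bool) (w c : ℕ → W) (n : ℕ) :
    (ladder g w c n).length ≤ 4 * n := by
  induction n with
  | zero => simp [ladder]
  | succ n ih =>
    rw [ladder, List.length_append]
    have := length_gadget_le (g n) (w n) (c n) (c (n + 1))
    omega

/-- Each gadget writes to a fresh zero wire, so adding there amounts to assigning. The second
conjunct, that all other wires are unchanged, is what keeps the later inputs and targets intact in
the induction. -/
theorem fwd_ladder (g : ℕ → Bool → Bool → Bool) (w c : ℕ → W) (n : ℕ) (x : W → Bool)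
    (hc : ∀ i j, i ≤ n → j ≤ n → c i = c j → i = j) (hw : ∀ i j, i < n → j ≤ n → w i ≠ c j)
    (hx : ∀ j, 1 ≤ j → j ≤ n → x (c j) = false) :
    fwd (ladder g w c n) x (c n) = ladderVal g (fun i => x (w i)) (x (c 0)) n ∧
      ∀ v, (∀ j, 1 ≤ j → j ≤ n → v ≠ c j) → fwd (ladder g w c n) x v = x v := by
  induction n with
  | zero => exact ⟨rfl, fun _ _ => rfl⟩
  | succ n ih =>
    obtain ⟨h1, h2⟩ := ih (fun i j hi hj => hc i j (by omega) (by omega))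
      (fun i j hi hj => hw i j (by omega) (by omega)) (fun j h hj => hx j h (by omega))
    have hcn : c n ≠ c (n + 1) := fun h => by
      have := hc n (n + 1) (by omega) le_rfl h
      omega
    rw [ladder, fwd_append, fwd_gadget _ (hw n (n + 1) (by omega) le_rfl) hcn]
    constructor
    · rw [Function.update_self, h1, h2 _ fun j _ hj => hw n j (by omega) (by omega),
        h2 (c (n + 1)) fun j _ hj h => by
          have := hc _ _ le_rfl (by omega) h
          omega, hx _ (by omega) le_rfl]
      simp [ladderVal]
    · intro v hv
      rw [Function.update_of_ne (hv _ (by omega) le_rfl)]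
      exact h2 v fun j h hj => hv j h (by omega)

/-- None of the gates acts on the wire `o`. -/
def Avoids (o : W) (L : List (W × W × W)) : Prop := ∀ g ∈ L, o ≠ g.1 ∧ o ≠ g.2.1 ∧ o ≠ g.2.2

theorem avoids_ladder (g : ℕ → Bool → Bool → Bool) (w c : ℕ → W) (n : ℕ) (o : W)
    (hc : ∀ i, i ≤ n → o ≠ c i) (hw : ∀ i, i < n → o ≠ w i) : Avoids o (ladder g w c n) := by
  induction n with
  | zero => intro g hg; simp [ladder] at hg
  | succ n ih =>
    intro e he
    rw [ladder, List.mem_append] at he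
    rcases he with he | he
    · exact ih (fun i hi => hc i (by omega)) (fun i hi => hw i (by omega)) e he
    · have h1 := hc n (by omega)
      have h2 := hc (n + 1) le_rfl
      have h3 := hw n (by omega)
      simp only [gadget, List.mem_append] at he
      rcases he with ((he | he) | he) | he <;> split_ifs at he <;>
        simp only [List.mem_singleton, List.not_mem_nil] at he <;> subst he <;>
        exact ⟨by assumption, by assumption, by assumption⟩

theorem fwd_update_of_avoids {o : W} {L : List (W × W × W)} (h : Avoids o L) (b : Bool)
    (x : W → Bool) : fwd L (Function.update x o b) = Function.update (fwd L x) o b := by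
  induction L generalizing x with
  | nil => rfl
  | cons g L ih =>
    have hg := h g (by simp)
    have : tog g (Function.update x o b) = Function.update (tog g x) o b := by
      unfold tog
      rw [Function.update_of_ne hg.1.symm, Function.update_of_ne hg.2.1.symm,
        Function.update_of_ne hg.2.2.symm]
      split_ifs
      · rw [Function.update_comm hg.2.2.symm]
      · rfl
    change fwd L (tog g (Function.update x o b)) = Function.update (fwd L (tog g x)) o b
    rw [this, ih fun e he => h e (List.mem_cons_of_mem _ he)]

/-- Computing a bit, adding it to the wire `o`, and uncomputing it. -/
theorem runOps_compute_copy (U V : Matrix (Bits q) (Bits q) ℂ) {L : List (W × W × W)} {w o : W}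
    (ho : Avoids o L) (hw : w ≠ o) (ψ : (W → Bool) → ℂ) :
    runOps U V (toggles q (L ++ [(w, w, o)] ++ L.reverse)) ψ =
      fun x => ψ (Function.update x o (xor (x o) (fwd L x w))) := by
  rw [runOps_toggles]
  ext x
  congr 1
  have hr : (L ++ [(w, w, o)] ++ L.reverse).reverse = L ++ [(w, w, o)] ++ L.reverse := by simp
  have ht : fwd [(w, w, o)] (fwd L x) =
      Function.update (fwd L x) o (xor (fwd L x o) (fwd L x w)) := by
    have := fwd_ite true w w o (fwd L x)
    simpa [hw] using this
  have hL : Avoids o L.reverse := fun g hg => ho g (List.mem_reverse.1 hg)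
  -- Writing to `o` the bit it already holds and commuting this past `L` shows that `L` preserves
  -- `o`.
  have hLo : fwd L x o = x o := by
    have := fwd_update_of_avoids ho (x o) x
    rw [Function.update_eq_self] at this
    rw [this, Function.update_self]
  rw [hr, fwd_append, fwd_append, ht, fwd_update_of_avoids hL, fwd_reverse_fwd, hLo]

end Gates

/-! ## The working register -/

theorem controlled_mk {ι : Type*} [DecidableEq ι] (c : Bool) (U : Matrix ι ι ℂ) (b b' : Bool)
    (i i' : ι) : controlled c U (b, i) (b', i') =
      if b = b' then (if b = c then U i i' else (1 : Matrix ι ι ℂ) i i') else 0 :=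
  controlled_apply c U (b, i) (b', i')

section WorkingRegister
variable {t q m : ℕ}

/-- The content of the working register. -/
def getWork (x : Wire t q m → Bool) : Bool × Bits q := (x Wire.aux, fun i => x (Wire.data i))

/-- The labels `x` with the working register replaced by `y`. -/
def setWork (x : Wire t q m → Bool) (y : Bool × Bits q) : Wire t q m → Bool
  | .inl (.inr (.inl _)) => y.1
  | .inl (.inr (.inr i)) => y.2 i
  | v => x v

@[simp] theorem getWork_setWork (x : Wire t q m → Bool) (y : Bool × Bits q) :
    getWork (setWork x y) = y := rfl

@[simp] theorem setWork_setWork (x : Wire t q m → Bool) (y z : Bool × Bits q) :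
    setWork (setWork x y) z = setWork x z := by
  ext v; rcases v with (_ | _ | _) | _ | _ <;> rfl

@[simp] theorem setWork_getWork (x : Wire t q m → Bool) : setWork x (getWork x) = x := by
  ext v; rcases v with (_ | _ | _) | _ | _ <;> rfl

@[simp] theorem setWork_phase (x : Wire t q m → Bool) (y : Bool × Bits q) (i : Fin t) :
    setWork x y (Wire.phase i) = x (Wire.phase i) := rfl

@[simp] theorem setWork_ancilla (x : Wire t q m → Bool) (y : Bool × Bits q) (i : Fin m) :
    setWork x y (Wire.ancilla i) = x (Wire.ancilla i) := rfl

@[simp] theorem setWork_out (x : Wire t q m → Bool) (y : Bool × Bits q) :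
    setWork x y Wire.out = x Wire.out := rfl

/-- The operator `M x` applied to the working register. -/
noncomputable def onWork (M : (Wire t q m → Bool) → Matrix (Bool × Bits q) (Bool × Bits q) ℂ)
    (ψ : (Wire t q m → Bool) → ℂ) : (Wire t q m → Bool) → ℂ :=
  fun x => ∑ y, M x (getWork x) y * ψ (setWork x y)

/-- The matrices may depend on wires outside the working register, which act as controls. The
hypothesis that `N` does not look at the register itself makes the composition a matrix product for
each value of the controls. -/
theorem onWork_onWork (M N : (Wire t q m → Bool) → Matrix (Bool × Bits q) (Bool × Bits q) ℂ)
    (hN : ∀ x y, N (setWork x y) = N x) (ψ : (Wire t q m → Bool) → ℂ) :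
    onWork M (onWork N ψ) = onWork (fun x => M x * N x) ψ := by
  ext x
  simp only [onWork, hN, getWork_setWork, setWork_setWork, Matrix.mul_apply, Finset.sum_mul,
    Finset.mul_sum]
  rw [Finset.sum_comm]
  simp only [mul_assoc]

theorem onWork_one (ψ : (Wire t q m → Bool) → ℂ) : onWork (fun _ => 1) ψ = ψ := by
  ext x
  rw [onWork, Finset.sum_eq_single (getWork x) (fun y _ hy => by
    rw [Matrix.one_apply_ne hy.symm, zero_mul]) (by simp)]
  simp

theorem onWork_diagonal (d : (Wire t q m → Bool) → Bool × Bits q → ℂ)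
    (ψ : (Wire t q m → Bool) → ℂ) :
    onWork (fun x => Matrix.diagonal (d x)) ψ = fun x => d x (getWork x) * ψ x := by
  ext x
  rw [onWork, Finset.sum_eq_single (getWork x) (fun y _ hy => by
    rw [Matrix.diagonal_apply_ne _ hy.symm, zero_mul]) (by simp)]
  simp

theorem extend_workingRegister (x : Wire t q m → Bool) (y : Unit ⊕ Fin q → Bool) :
    Function.extend (workingRegister t q m) y x =
      setWork x (y (.inl ()), fun i => y (.inr i)) := by
  ext v
  rcases v with (v | v | v) | v
  · rw [Function.extend_apply']
    · rfl
    · rintro ⟨a, ha⟩; cases (show (Sum.inl (Sum.inr a) : Wire t q m) = _ from ha)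
  · exact (workingRegister t q m).injective.extend_apply y x (.inl ())
  · exact (workingRegister t q m).injective.extend_apply y x (.inr v)
  · rw [Function.extend_apply']
    · rcases v with _ | _ <;> rfl
    · rintro ⟨a, ha⟩; cases (show (Sum.inl (Sum.inr a) : Wire t q m) = _ from ha)

/-- Labels of the wires of the working register. -/
def workEquiv (q : ℕ) : (Unit ⊕ Fin q → Bool) ≃ Bool × Bits q where
  toFun z := (z (.inl ()), fun i => z (.inr i))
  invFun y := Sum.elim (fun _ => y.1) y.2
  left_inv z := by ext (_ | _) <;> rfl
  right_inv y := rfl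

theorem applyOn_workingRegister (c : Wire t q m)
    (Q : Matrix (Bool × Bits q) (Bool × Bits q) ℂ) (ψ : (Wire t q m → Bool) → ℂ) :
    applyOn {c} (workingRegister t q m) (onWires Q) ψ =
      onWork (fun x => if x c = true then Q else 1) ψ := by
  ext x
  rw [applyOn]
  simp only [Finset.mem_singleton, forall_eq]
  split_ifs with h
  · simp only [extend_workingRegister, onWork, h, if_true]
    rw [← (workEquiv q).sum_comp]
    rfl
  · have := congrFun (onWork_one ψ) x
    simp only [onWork, h] at this ⊢
    exact this.symm

theorem hadamard_aux_apply (ψ : (Wire t q m → Bool) → ℂ) :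
    (ctrlGate hadamardGate Wire.aux Wire.aux Wire.aux).apply ψ =
      onWork (fun _ => hadamard ⊗ₖ (1 : Matrix (Bits q) (Bits q) ℂ)) ψ := by
  ext x
  rw [ctrlGate_apply, if_pos ⟨fun h => absurd rfl h, fun h => absurd rfl h⟩, onWork,
    Fintype.sum_prod_type]
  refine Finset.sum_congr rfl fun b _ => ?_
  rw [Finset.sum_eq_single (getWork x).2 (fun d _ hd => by
    rw [hadamard_kronecker_one_apply, if_neg hd.symm, zero_mul]) (by simp),
    hadamard_kronecker_one_apply, if_pos rfl]
  have : Function.update x Wire.aux b = setWork x (b, (getWork x).2) := by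
    ext v
    rcases v with (_ | _ | _) | _ | _ <;> rfl
  rw [this]
  rfl

/-- The data wires. -/
def dataRegister (t q m : ℕ) : Fin q ↪ Wire t q m :=
  ⟨fun i => Wire.data i, fun _ _ h => Sum.inr_injective (Sum.inr_injective (Sum.inl_injective h))⟩

theorem dataRegister_ne_aux (i : Fin q) : dataRegister t q m i ≠ Wire.aux := by
  intro h
  cases (show (Sum.inl (Sum.inr (Sum.inr i)) : Wire t q m) = _ from h)

theorem applyOn_dataRegister (V : Matrix (Bits q) (Bits q) ℂ) (ψ : (Wire t q m → Bool) → ℂ) :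
    applyOn {Wire.aux} (dataRegister t q m) V ψ = onWork (fun _ => controlled true V) ψ := by
  ext x
  rw [applyOn, onWork, Fintype.sum_prod_type, Finset.sum_eq_single (x Wire.aux) (fun b _ hb => by
    refine Finset.sum_eq_zero fun d _ => ?_
    rw [getWork, controlled_mk, if_neg (fun h => hb h.symm), zero_mul]) (by simp), getWork]
  have he : ∀ y : Bits q, Function.extend (dataRegister t q m) y x = setWork x (x Wire.aux, y) := by
    intro y
    ext v
    rcases v with (v | v | v) | v
    · rw [Function.extend_apply']
      · rfl
      · rintro ⟨a, ha⟩; cases (show (Sum.inl (Sum.inr (Sum.inr a)) : Wire t q m) = _ from ha)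
    · rw [Function.extend_apply']
      · rfl
      · rintro ⟨a, ha⟩; cases (show (Sum.inl (Sum.inr (Sum.inr a)) : Wire t q m) = _ from ha)
    · exact (dataRegister t q m).injective.extend_apply y x v
    · rw [Function.extend_apply']
      · rcases v with _ | _ <;> rfl
      · rintro ⟨a, ha⟩; cases (show (Sum.inl (Sum.inr (Sum.inr a)) : Wire t q m) = _ from ha)
  simp only [Finset.mem_singleton, forall_eq, controlled_mk, he]
  by_cases h : x Wire.aux = true
  · simp only [h, if_true]
    rfl
  · simp only [Bool.not_eq_true] at h
    simp only [h, if_true, Bool.false_eq_true, if_false]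
    rw [Finset.sum_eq_single (fun i => x (Wire.data i)) (fun d _ hd => by
      rw [Matrix.one_apply_ne hd.symm, zero_mul]) (by simp), Matrix.one_apply_eq, one_mul, ← h]
    exact congrArg ψ (setWork_getWork x).symm

/-- The gates of the product of `X` gates with pattern `k`, applied if the auxiliary qubit is
`0`. -/
def flipTogs (t m : ℕ) (k : Bits q) : List (Wire t q m × Wire t q m × Wire t q m) :=
  [(Wire.aux, Wire.aux, Wire.aux)] ++
    ((List.finRange q).filter fun i => k i).map (fun i => (Wire.aux, Wire.aux, Wire.data i)) ++
    [(Wire.aux, Wire.aux, Wire.aux)]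

/-- All targets are data wires, so the common control never changes. Repeated targets would cancel,
hence `Nodup`. -/
theorem fwd_cnots (l : List (Fin q)) (hl : l.Nodup) (x : Wire t q m → Bool) :
    fwd (l.map fun i => (Wire.aux, Wire.aux, Wire.data i)) x =
      setWork x (x Wire.aux, fun i => xor (x (Wire.data i)) (x Wire.aux && decide (i ∈ l))) := by
  induction l generalizing x with
  | nil =>
    have := setWork_getWork x
    simpa [getWork, fwd] using this.symm
  | cons j l ih =>
    rw [List.nodup_cons] at hl
    change fwd _ (tog (Wire.aux, Wire.aux, Wire.data j) x) = _
    rw [ih hl.2, tog_of_ne _ _ (by simp)]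
    have ht : tog (Wire.aux, Wire.aux, Wire.data j) x =
        setWork x (x Wire.aux, fun i => xor (x (Wire.data i)) (x Wire.aux && decide (i = j))) := by
      have := fwd_ite true (Wire.aux : Wire t q m) Wire.aux (Wire.data j) x
      simp only [fwd, if_true, List.foldl_cons, List.foldl_nil] at this
      rw [this]
      ext v
      rcases v with (v | v | v) | v | v
      · rfl
      · rfl
      · by_cases h : v = j
        · subst h; simp [setWork]
        · simp [setWork, h]
      · rfl
      · rfl
    rw [ht, setWork_setWork]
    congr 2
    ext i
    by_cases h : i = j
    · subst h; simp [setWork, hl.1]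
    · simp [setWork, h]

/-- Negating the auxiliary qubit before and after turns a control on `1` into a control on `0`.
Reversal only permutes the `CNOT` gates in the middle. -/
theorem fwd_flipTogs (k : Bits q) (x : Wire t q m → Bool) :
    fwd (flipTogs t m k).reverse x =
      setWork x (x Wire.aux, fun i => xor (x (Wire.data i)) (!x Wire.aux && k i)) := by
  have ht : ∀ x : Wire t q m → Bool, fwd [(Wire.aux, Wire.aux, Wire.aux)] x =
      setWork x (!x Wire.aux, fun i => x (Wire.data i)) := by
    intro x
    ext v
    rcases v with (v | v | v) | v | v <;> simp [fwd, tog, setWork]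
  rw [flipTogs, List.reverse_append, List.reverse_append, List.reverse_singleton,
    ← List.map_reverse, fwd_append, fwd_append, ht, ht, fwd_cnots _ (by
      rw [List.nodup_reverse]; exact (List.nodup_finRange q).filter _)]
  simp [setWork_setWork, setWork]

theorem runOps_flipTogs (U V : Matrix (Bits q) (Bits q) ℂ) (k : Bits q)
    (ψ : (Wire t q m → Bool) → ℂ) :
    runOps U V (toggles q (flipTogs t m k)) ψ = onWork (fun _ => controlled false (flip k)) ψ := by
  rw [runOps_toggles]
  ext x
  rw [fwd_flipTogs, onWork, Finset.sum_eq_single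
    (x Wire.aux, fun i => xor (x (Wire.data i)) (!x Wire.aux && k i))]
  · rw [getWork, controlled_mk]
    cases h : x Wire.aux
    · simp [flip]
    · have e : (fun i => xor (x (Wire.data i)) (!true && k i)) = fun i => x (Wire.data i) := by
        ext i; simp
      rw [e]
      simp
  · rintro ⟨b, d⟩ _ hd
    rw [getWork, controlled_mk]
    by_cases hb : x Wire.aux = b
    · subst hb
      cases h : x Wire.aux
      · have : ¬ (fun i => x (Wire.data i)) = fun l => xor (d l) (k l) := by
          intro h'
          apply hd
          rw [h]
          congr 1
          ext i
          have := congrFun h' i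
          simp [this]
        simp [flip, this]
      · have : (fun i => x (Wire.data i)) ≠ d := by
          rintro rfl
          apply hd
          rw [h]
          simp
        simp [Matrix.one_apply_ne this]
    · rw [if_neg hb, zero_mul]
  · simp

/-- The operations of the state preparation. -/
noncomputable def prepOps (t m : ℕ) (k : Bits q) : List (Op q (Wire t q m)) :=
  [.gate (ctrlGate hadamardGate Wire.aux Wire.aux Wire.aux),
    .cquery false Wire.aux (dataRegister t q m) dataRegister_ne_aux] ++
  toggles q (flipTogs t m k) ++ [.gate (ctrlGate hadamardGate Wire.aux Wire.aux Wire.aux)]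

/-- The operations of the inverse of the state preparation. -/
noncomputable def unprepOps (t m : ℕ) (k : Bits q) : List (Op q (Wire t q m)) :=
  [.gate (ctrlGate hadamardGate Wire.aux Wire.aux Wire.aux)] ++ toggles q (flipTogs t m k) ++
  [.cquery true Wire.aux (dataRegister t q m) dataRegister_ne_aux,
    .gate (ctrlGate hadamardGate Wire.aux Wire.aux Wire.aux)]

theorem runOps_prepOps (U V : Matrix (Bits q) (Bits q) ℂ) (k : Bits q)
    (ψ : (Wire t q m → Bool) → ℂ) :
    runOps U V (prepOps t m k) ψ = onWork (fun _ => prep V k) ψ := by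
  rw [prepOps, runOps_append, runOps_append, runOps_gate, runOps_flipTogs, hadamard_aux_apply]
  change onWork _ (onWork _ (applyOn {Wire.aux} (dataRegister t q m) V
    ((ctrlGate hadamardGate Wire.aux Wire.aux Wire.aux).apply ψ))) = _
  rw [hadamard_aux_apply, applyOn_dataRegister, onWork_onWork _ _ (fun _ _ => rfl),
    onWork_onWork _ _ (fun _ _ => rfl), onWork_onWork _ _ (fun _ _ => rfl)]
  simp only [prep, mul_assoc]

theorem hadamard_conjTranspose : hadamardᴴ = hadamard := by
  ext i j
  cases i <;> cases j <;> simp [hadamard]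

/-- The Hadamard gate and the flip are self-adjoint, so in the reversed circuit only the oracle call
has to be inverted. -/
theorem runOps_unprepOps (U V : Matrix (Bits q) (Bits q) ℂ) (k : Bits q)
    (ψ : (Wire t q m → Bool) → ℂ) :
    runOps U V (unprepOps t m k) ψ = onWork (fun _ => (prep V k)ᴴ) ψ := by
  rw [unprepOps, runOps_append, runOps_append, runOps_gate, runOps_flipTogs, hadamard_aux_apply]
  change (ctrlGate hadamardGate Wire.aux Wire.aux Wire.aux).apply
    (applyOn {Wire.aux} (dataRegister t q m) Vᴴ _) = _
  rw [hadamard_aux_apply, applyOn_dataRegister, onWork_onWork _ _ (fun _ _ => rfl),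
    onWork_onWork _ _ (fun _ _ => rfl), onWork_onWork _ _ (fun _ _ => rfl)]
  simp only [prep, mul_assoc, Matrix.conjTranspose_mul, controlled_conjTranspose,
    flip_conjTranspose, Matrix.conjTranspose_kronecker, hadamard_conjTranspose,
    Matrix.conjTranspose_one]

end WorkingRegister

/-! ## The subcircuit -/

section Body
variable {t q M : ℕ}

/-- The ancillas as a sequence; the first one is the control of the subcircuit. -/
def chain (t q M : ℕ) (j : ℕ) : Wire t q (M + 1) := Wire.ancilla (Fin.ofNat (M + 1) j)

theorem chain_inj {i j : ℕ} (hi : i ≤ M) (hj : j ≤ M) (h : chain t q M i = chain t q M j) :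
    i = j := by
  have h1 : Fin.ofNat (M + 1) i = Fin.ofNat (M + 1) j := Sum.inr_injective (Sum.inr_injective h)
  have h2 := congrArg Fin.val h1
  simp only [Fin.ofNat] at h2
  rwa [Nat.mod_eq_of_lt (by omega), Nat.mod_eq_of_lt (by omega)] at h2

/-- The wires of the working register as a sequence. -/
def workWire (t q M : ℕ) : ℕ → Wire t q (M + 1)
  | 0 => Wire.aux
  | i + 1 => if h : i < q then Wire.data ⟨i, h⟩ else Wire.aux

/-- No bound on `i` is needed because the default value of `workWire` is itself a working wire. -/
theorem workWire_ne_ancilla (i : ℕ) (j : Fin (M + 1)) : workWire t q M i ≠ Wire.ancilla j := by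
  cases i with
  | zero => simp [workWire]
  | succ i =>
    rw [workWire]
    split_ifs <;> simp

/-- The bits of the pattern `|0⟩ ⊗ |k⟩` as a sequence. -/
def workPattern (k : Bits q) : ℕ → Bool
  | 0 => false
  | i + 1 => if h : i < q then k ⟨i, h⟩ else false

/-- The gates that compare the working register with the pattern `|0⟩ ⊗ |k⟩`. -/
def matchTogs (t M : ℕ) (k : Bits q) :
    List (Wire t q (M + 1) × Wire t q (M + 1) × Wire t q (M + 1)) :=
  ladder (fun i b v => (b == workPattern k i) && v) (workWire t q M) (chain t q M) (q + 1)

theorem ladderVal_and (p inp : ℕ → Bool) (v : Bool) (n : ℕ) :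
    ladderVal (fun i b v => (b == p i) && v) inp v n = true ↔
      v = true ∧ ∀ i < n, inp i = p i := by
  induction n with
  | zero => simp [ladderVal]
  | succ n ih =>
    simp only [ladderVal, Bool.and_eq_true, beq_iff_eq, ih, Nat.lt_succ_iff_lt_or_eq]
    constructor
    · rintro ⟨h1, h2, h3⟩
      exact ⟨h2, fun i hi => hi.elim (h3 i) fun h => h ▸ h1⟩
    · rintro ⟨h1, h2⟩
      exact ⟨h2 n (Or.inr rfl), h1, fun i hi => h2 i (Or.inl hi)⟩

/-- The ladder starts from the control qubit instead of a constant, so the computed conjunction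
already includes the control. The `q + 1` compared bits need as many zero ancillas besides it. -/
theorem fwd_matchTogs (hM : q + 1 ≤ M) (k : Bits q) (x : Wire t q (M + 1) → Bool)
    (hx : ∀ i, i ≠ 0 → x (Wire.ancilla i) = false) :
    fwd (matchTogs t M k) x (chain t q M (q + 1)) = true ↔
      x (Wire.ancilla 0) = true ∧ getWork x = (false, k) := by
  rw [matchTogs, (fwd_ladder _ _ _ _ x (fun i j hi hj => chain_inj (by omega) (by omega))
    (fun i j _ _ => workWire_ne_ancilla i _) ?_).1, ladderVal_and]
  · refine and_congr Iff.rfl ?_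
    constructor
    · intro h
      refine Prod.ext (h 0 (by omega)) ?_
      ext i
      have := h (i + 1) (by omega)
      simpa [workWire, workPattern, getWork] using this
    · intro h i hi
      have h1 : x Wire.aux = false := congrArg Prod.fst h
      have h2 : ∀ i, x (Wire.data i) = k i := fun i => congrFun (congrArg Prod.snd h) i
      cases i with
      | zero => exact h1
      | succ i => simp [workWire, workPattern, show i < q by omega, h2]
  · intro j h1 hj
    refine hx _ fun h => ?_
    have := congrArg Fin.val h
    simp only [Fin.ofNat, Fin.val_zero] at this
    rw [Nat.mod_eq_of_lt (by omega)] at this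
    omega

/-- The operations of the controlled reflection about `|0⟩ ⊗ |k⟩`. -/
noncomputable def reflectOps (t M : ℕ) (k : Bits q) : List (Op q (Wire t q (M + 1))) :=
  toggles q (matchTogs t M k) ++ [.gate (ctrlGate (phaseGate Real.pi) (chain t q M (q + 1))
    (chain t q M (q + 1)) (chain t q M (q + 1)))] ++ toggles q (matchTogs t M k).reverse

/-- All ancillas other than the control are zero. -/
def Clean (ψ : (Wire t q (M + 1) → Bool) → ℂ) : Prop :=
  ∀ x, (∃ i, i ≠ 0 ∧ x (Wire.ancilla i) = true) → ψ x = 0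

theorem Clean.onWork {ψ : (Wire t q (M + 1) → Bool) → ℂ} (h : Clean ψ)
    (N : (Wire t q (M + 1) → Bool) → Matrix (Bool × Bits q) (Bool × Bits q) ℂ) :
    Clean (onWork N ψ) := by
  rintro x ⟨i, hi, hx⟩
  refine Finset.sum_eq_zero fun y _ => ?_
  rw [h _ ⟨i, hi, by simpa using hx⟩, mul_zero]

theorem reflection_eq_diagonal {ι : Type*} [DecidableEq ι] (v : ι) :
    reflection v = Matrix.diagonal fun y => if y = v then -1 else 1 := by
  ext i j
  by_cases hij : i = j
  · subst hij
    by_cases hi : i = v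
    · subst hi; norm_num [reflection, proj]
    · simp [reflection, proj, hi, Ne.symm hi]
  · have : ¬ (v = i ∧ v = j) := by rintro ⟨rfl, rfl⟩; exact hij rfl
    simp [reflection, proj, Matrix.one_apply_ne hij, Matrix.diagonal_apply_ne _ hij,
      this]

/-- The reflection is diagonal, so computing the matching bit, a sign on it and uncomputing perform
it. The matching bit is right only on zero ancillas; on all other labels both sides vanish. -/
theorem runOps_reflectOps (U V : Matrix (Bits q) (Bits q) ℂ) (hM : q + 1 ≤ M) (k : Bits q)
    {ψ : (Wire t q (M + 1) → Bool) → ℂ} (hψ : Clean ψ) :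
    runOps U V (reflectOps t M k) ψ =
      onWork (fun x => if x (Wire.ancilla 0) = true then reflection (false, k) else 1) ψ := by
  have h : (fun x : Wire t q (M + 1) → Bool => if x (Wire.ancilla 0) = true then
      reflection (false, k) else 1) = fun x => Matrix.diagonal fun y =>
        if x (Wire.ancilla 0) = true ∧ y = (false, k) then (-1 : ℂ) else 1 := by
    ext1 x
    cases x (Wire.ancilla 0) <;> simp [reflection_eq_diagonal]
  rw [h, onWork_diagonal]
  ext x
  rw [reflectOps, runOps_phase_kick]
  by_cases hx : ∃ i, i ≠ 0 ∧ x (Wire.ancilla i) = true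
  · rw [hψ x hx, mul_zero, mul_zero]
  · push Not at hx
    congr 1
    exact if_congr (fwd_matchTogs hM k x fun i hi => by simpa using hx i hi) rfl rfl

/-- The operations of the controlled Grover iterator. -/
noncomputable def bodyOps (t M : ℕ) (k : Bits q) : List (Op q (Wire t q (M + 1))) :=
  reflectOps t M k ++ unprepOps t (M + 1) k ++ reflectOps t M (zeros q) ++ prepOps t (M + 1) k ++
    [.gate (ctrlGate (phaseGate Real.pi) (Wire.ancilla 0) (Wire.ancilla 0) (Wire.ancilla 0))]

/-- The preparation and its inverse run uncontrolled: with the control off the reflections are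
trivial and `A A† = 1`. The final phase gate on the control supplies the minus sign of the iterator.
-/
theorem runOps_bodyOps (U : Matrix (Bits q) (Bits q) ℂ) {V : Matrix (Bits q) (Bits q) ℂ}
    (hV : V ∈ Matrix.unitaryGroup (Bits q) ℂ) (hM : q + 1 ≤ M) (k : Bits q)
    {ψ : (Wire t q (M + 1) → Bool) → ℂ} (hψ : Clean ψ) :
    runOps U V (bodyOps t M k) ψ =
      onWork (fun x => if x (Wire.ancilla 0) = true then iterator V k else 1) ψ := by
  have hA : prep V k * (prep V k)ᴴ = 1 :=
    Matrix.mem_unitaryGroup_iff.1 (prep_mem_unitaryGroup hV k)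
  have hz : ∀ φ : (Wire t q (M + 1) → Bool) → ℂ,
      (ctrlGate (phaseGate Real.pi) (Wire.ancilla 0) (Wire.ancilla 0) (Wire.ancilla 0)).apply φ =
        onWork (fun x => if x (Wire.ancilla 0) = true then -1 else 1) φ := by
    intro φ
    have h : (fun x : Wire t q (M + 1) → Bool => if x (Wire.ancilla 0) = true then
        (-1 : Matrix (Bool × Bits q) (Bool × Bits q) ℂ) else 1) = fun x => Matrix.diagonal fun _ =>
          if x (Wire.ancilla 0) = true then (-1 : ℂ) else 1 := by
      ext1 x
      cases x (Wire.ancilla 0)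
      · simp
      · simp [← Matrix.diagonal_one, Matrix.diagonal_neg]
    rw [h, onWork_diagonal]
    ext x
    rw [phaseGate_apply, Complex.exp_pi_mul_I]
    simp
  rw [bodyOps, runOps_append, runOps_append, runOps_append, runOps_append,
    runOps_reflectOps U V hM k hψ, runOps_unprepOps,
    runOps_reflectOps U V hM (zeros q) ((hψ.onWork _).onWork _), runOps_prepOps, runOps_gate, hz,
    onWork_onWork _ _ (fun _ _ => rfl), onWork_onWork _ _ (fun _ _ => rfl),
    onWork_onWork _ _ (fun _ _ => rfl), onWork_onWork _ _ (fun _ _ => rfl)]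
  congr 1
  ext1 x
  cases x (Wire.ancilla 0)
  · simp [hA]
  · simp [iterator, grover, mul_assoc]

end Body

/-! ## Gate counts -/

section Counts
variable {W : Type*} [DecidableEq W] {q : ℕ}

theorem countP_toggles (L : List (W × W × W)) :
    (toggles q L).countP Op.isGate = L.length := by
  induction L with
  | nil => rfl
  | cons g L ih =>
    change ((Op.gate _ : Op q W) :: toggles q L).countP Op.isGate = _
    rw [List.countP_cons_of_pos rfl, ih]
    rfl

theorem countP_not_toggles (L : List (W × W × W)) :
    (toggles q L).countP (fun o => !o.isGate) = 0 := by
  induction L with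
  | nil => rfl
  | cons g L ih =>
    change ((Op.gate _ : Op q W) :: toggles q L).countP _ = _
    rw [List.countP_cons_of_neg (by simp [Op.isGate]), ih]

variable {t m M : ℕ}

theorem length_flipTogs_le (k : Bits q) : (flipTogs t m k).length ≤ q + 2 := by
  have := List.length_filter_le (fun i => k i) (List.finRange q)
  rw [List.length_finRange] at this
  simp only [flipTogs, List.length_append, List.length_map, List.length_singleton]
  omega

theorem countP_prepOps_le (k : Bits q) : (prepOps t m k).countP Op.isGate ≤ q + 4 := by
  have := length_flipTogs_le (t := t) (m := m) k
  simp only [prepOps, List.countP_append, countP_toggles, List.countP_cons, List.countP_nil,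
    Op.isGate]
  simp
  omega

theorem countP_unprepOps_le (k : Bits q) : (unprepOps t m k).countP Op.isGate ≤ q + 4 := by
  have := length_flipTogs_le (t := t) (m := m) k
  simp only [unprepOps, List.countP_append, countP_toggles, List.countP_cons, List.countP_nil,
    Op.isGate]
  simp
  omega

theorem countP_not_prepOps (k : Bits q) :
    (prepOps t m k).countP (fun o => !o.isGate) = 1 := by
  rw [prepOps, List.countP_append, List.countP_append, countP_not_toggles]
  rfl

theorem countP_not_unprepOps (k : Bits q) :
    (unprepOps t m k).countP (fun o => !o.isGate) = 1 := by
  rw [unprepOps, List.countP_append, List.countP_append, countP_not_toggles]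
  rfl

/-- A ladder of at most `4 (q + 1)` gates, its reversal, and one phase gate. -/
theorem countP_reflectOps_le (k : Bits q) :
    (reflectOps t M k).countP Op.isGate ≤ 8 * q + 9 := by
  have := length_ladder_le (fun i b v => (b == workPattern k i) && v) (workWire t q M)
    (chain t q M) (q + 1)
  simp only [reflectOps, matchTogs, List.countP_append, countP_toggles, List.countP_cons,
    List.countP_nil, Op.isGate, List.length_reverse]
  simp
  omega

theorem countP_not_reflectOps (k : Bits q) :
    (reflectOps t M k).countP (fun o => !o.isGate) = 0 := by
  rw [reflectOps, List.countP_append, List.countP_append, countP_not_toggles, countP_not_toggles]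
  rfl

theorem countP_bodyOps_le (k : Bits q) : (bodyOps t M k).countP Op.isGate ≤ 18 * q + 27 := by
  have h1 := countP_reflectOps_le (t := t) (M := M) k
  have h2 := countP_reflectOps_le (t := t) (M := M) (zeros q)
  have h3 := countP_prepOps_le (t := t) (m := M + 1) k
  have h4 := countP_unprepOps_le (t := t) (m := M + 1) k
  simp only [bodyOps, List.countP_append, List.countP_cons, List.countP_nil, Op.isGate]
  simp
  omega

theorem countP_not_bodyOps (k : Bits q) :
    (bodyOps t M k).countP (fun o => !o.isGate) = 2 := by
  simp only [bodyOps, List.countP_append, countP_not_reflectOps, countP_not_prepOps,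
    countP_not_unprepOps]
  rfl

end Counts

/-! ## The inverse quantum Fourier transform -/

section Fourier
variable {t q m : ℕ}

/-- The labels `x` with the phase register replaced by `b`. -/
def setPhase (x : Wire t q m → Bool) (b : Bits t) : Wire t q m → Bool
  | .inl (.inl i) => b i
  | v => x v

/-- The content of the phase register. -/
def getPhase (x : Wire t q m → Bool) : Bits t := fun i => x (Wire.phase i)

/-- A Hadamard gate on the qubit `i` of the phase register, followed by the controlled phases with
the qubits of smaller index. -/
noncomputable def fourierBlock (q m : ℕ) (i : Fin t) : List (Op q (Wire t q m)) :=
  .gate (ctrlGate hadamardGate (Wire.phase i) (Wire.phase i) (Wire.phase i)) ::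
    ((List.finRange t).filter fun l => l < i).map fun l : Fin t =>
      .gate (ctrlGate (phaseGate (-(Real.pi / 2 ^ ((i : ℕ) - l)))) (Wire.phase l) (Wire.phase l)
        (Wire.phase i))

/-- The inverse quantum Fourier transform without the bit reversal, restricted to the last `n`
qubits of the phase register. -/
noncomputable def fourierOps (t q m : ℕ) : ℕ → List (Op q (Wire t q m))
  | 0 => []
  | n + 1 => fourierOps t q m n ++
      if h : n < t then fourierBlock q m (⟨t - 1 - n, by omega⟩ : Fin t) else []

/-- The factor of the qubit `i` in the kernel of the Fourier transform. -/
noncomputable def fourierFactor (a b : Bits t) (i : Fin t) : ℂ :=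
  hadamard (a i) (b i) * ∏ l : Fin t, if l < i ∧ b l = true ∧ a i = true then
    Complex.exp ((-(Real.pi / 2 ^ ((i : ℕ) - l)) : ℝ) * Complex.I) else 1

theorem runOps_phases (U V : Matrix (Bits q) (Bits q) ℂ) (i : Fin t) (L : List (Fin t))
    (φ : Fin t → ℝ) (ψ : (Wire t q m → Bool) → ℂ) :
    runOps U V (L.map fun l => .gate (ctrlGate (phaseGate (φ l)) (Wire.phase l) (Wire.phase l)
        (Wire.phase i))) ψ = fun x =>
      (L.map fun l => if x (Wire.phase l) = true ∧ x (Wire.phase i) = true then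
        Complex.exp (φ l * Complex.I) else 1).prod * ψ x := by
  induction L generalizing ψ with
  | nil => ext x; simp [runOps]
  | cons l L ih =>
    change runOps U V (L.map _) ((ctrlGate _ _ _ _).apply ψ) = _
    rw [ih]
    ext x
    rw [phaseGate_apply, List.map_cons, List.prod_cons]
    ring

theorem runOps_fourierBlock (U V : Matrix (Bits q) (Bits q) ℂ) (i : Fin t)
    (ψ : (Wire t q m → Bool) → ℂ) (x : Wire t q m → Bool) :
    runOps U V (fourierBlock q m i) ψ x =
      (∏ l : Fin t, if l < i ∧ x (Wire.phase l) = true ∧ x (Wire.phase i) = true then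
        Complex.exp ((-(Real.pi / 2 ^ ((i : ℕ) - l)) : ℝ) * Complex.I) else 1) *
      ∑ c : Bool, hadamard (x (Wire.phase i)) c * ψ (Function.update x (Wire.phase i) c) := by
  change runOps U V (List.map _ _) ((ctrlGate _ _ _ _).apply ψ) x = _
  rw [runOps_phases U V i _ (fun l => -(Real.pi / 2 ^ ((i : ℕ) - l)))]
  beta_reduce
  rw [ctrlGate_apply, if_pos ⟨fun h => absurd rfl h, fun h => absurd rfl h⟩]
  congr 1
  rw [← List.prod_toFinset _ ((List.nodup_finRange t).filter _), List.toFinset_filter,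
    List.toFinset_finRange, Finset.prod_filter]
  refine Finset.prod_congr rfl fun l _ => ?_
  by_cases h : l < i <;> simp [h]

/-- The qubits are processed from the last to the first, and the phases of a block are controlled by
qubits not yet processed, which still hold their input bits. So each block contributes one factor of
a sum over inputs `b` that agree with the output on the untouched qubits. -/
theorem runOps_fourierOps (U V : Matrix (Bits q) (Bits q) ℂ) (n : ℕ) (hn : n ≤ t)
    (ψ : (Wire t q m → Bool) → ℂ) (x : Wire t q m → Bool) :
    runOps U V (fourierOps t q m n) ψ x = ∑ b : Bits t,
      if ∀ i : Fin t, i + n < t → b i = x (Wire.phase i) then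
        (∏ i : Fin t, if t ≤ i + n then fourierFactor (getPhase x) b i else 1) *
          ψ (setPhase x b) else 0 := by
  induction n generalizing x with
  | zero =>
    rw [Finset.sum_eq_single (getPhase x)]
    · have hx : ∀ i : Fin t, i + 0 < t → getPhase x i = x (Wire.phase i) := fun _ _ => rfl
      rw [if_pos hx, Finset.prod_eq_one, one_mul]
      · change ψ x = _
        congr 1
        ext v
        rcases v with (_ | _ | _) | _ | _ <;> rfl
      · intro i _
        rw [if_neg (by have := i.isLt; omega)]
    · intro b _ hb
      rw [if_neg]
      intro h
      exact hb (funext fun i => h i (by have := i.isLt; omega))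
    · simp
  | succ n ih =>
    rw [fourierOps, dif_pos (by omega), runOps_append, runOps_fourierBlock]
    set i : Fin t := ⟨t - 1 - n, by omega⟩ with hi
    have hiv : (i : ℕ) = t - 1 - n := rfl
    simp only [ih (by omega), Finset.mul_sum]
    rw [Finset.sum_comm]
    refine Finset.sum_congr rfl fun b _ => ?_
    have hset : ∀ c, setPhase (Function.update x (Wire.phase i) c) b = setPhase x b := by
      intro c
      ext v
      rcases v with (v | v | v) | v | v <;> simp [setPhase]
    simp only [hset]
    -- The earlier blocks leave qubit `i` untouched, so only the summand whose bit equals the input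
    -- bit `b i` survives.
    rw [Finset.sum_eq_single (b i)]
    · have hcond : (∀ j : Fin t, j + n < t →
          b j = Function.update x (Wire.phase i) (b i) (Wire.phase j)) ↔
          ∀ j : Fin t, j + (n + 1) < t → b j = x (Wire.phase j) := by
        constructor
        · intro h j hj
          have hne : j ≠ i := fun h => by rw [h, hiv] at hj; omega
          rw [h j (by omega), Function.update_of_ne (by simpa using hne)]
        · intro h j hj
          by_cases hne : j = i
          · subst hne; simp
          · rw [Function.update_of_ne (by simpa using hne)]
            refine h j ?_
            have : (j : ℕ) ≠ i := fun h => hne (Fin.ext h)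
            omega
      rw [if_congr hcond rfl rfl]
      split_ifs with h
      · have hprod : (∏ j : Fin t, if t ≤ j + (n + 1) then fourierFactor (getPhase x) b j else 1) =
            fourierFactor (getPhase x) b i * ∏ j : Fin t, if t ≤ j + n then
              fourierFactor (getPhase (Function.update x (Wire.phase i) (b i))) b j else 1 := by
          rw [← Finset.mul_prod_erase _ _ (Finset.mem_univ i),
            ← Finset.mul_prod_erase _ (fun j : Fin t => if t ≤ j + n then fourierFactor
              (getPhase (Function.update x (Wire.phase i) (b i))) b j else 1) (Finset.mem_univ i),
            if_pos (by omega), if_neg (by omega), one_mul]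
          congr 1
          refine Finset.prod_congr rfl fun j hj => ?_
          have hne := Finset.ne_of_mem_erase hj
          have hne' : (j : ℕ) ≠ i := fun h => hne (Fin.ext h)
          refine if_congr (by omega) ?_ rfl
          have : getPhase (Function.update x (Wire.phase i) (b i)) j = getPhase x j := by
            rw [getPhase, Function.update_of_ne (by simpa using hne)]; rfl
          rw [fourierFactor, fourierFactor, this]
        rw [hprod, fourierFactor]
        have hph : ∀ l : Fin t, (l < i ∧ x (Wire.phase l) = true ∧ x (Wire.phase i) = true) ↔
            (l < i ∧ b l = true ∧ getPhase x i = true) := by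
          intro l
          refine and_congr_right fun hl => ?_
          rw [h l (by have : (l : ℕ) < i := hl; omega)]
          rfl
        simp only [hph]
        change _ * (hadamard (getPhase x i) (b i) * _) = _
        ring
      · simp
    · intro c _ hc
      rw [if_neg, mul_zero, mul_zero]
      intro h
      have := h i (by omega)
      rw [Function.update_self] at this
      exact hc this.symm
    · simp

/-- The integer with the binary digits of `b` in increasing order of significance. -/
def rval (b : Bits t) : ℕ := ∑ i : Fin t, if b i then 2 ^ (i : ℕ) else 0

/-- In `val a * rval b / 2^t` the bits `a i` and `b l` meet with weight `2^(l - i - 1)`. For `l > i`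
this is an integer and gives no phase, for `l = i` it is `1/2` and gives the Hadamard sign, and for
`l < i` it gives the controlled phases. `rval` appears because the bit reversal is omitted. -/
theorem prod_fourierFactor (a b : Bits t) : ∏ i, fourierFactor a b i =
    Complex.exp (-(2 * Real.pi * Complex.I * (val a * rval b : ℕ) / (2 ^ t : ℕ))) /
      (Real.sqrt 2 : ℂ) ^ t := by
  have hexp : Complex.exp (-(2 * Real.pi * Complex.I * (val a * rval b : ℕ) / (2 ^ t : ℕ))) =
      ∏ i : Fin t, ∏ l : Fin t, if b l = true ∧ a i = true then
        Complex.exp (-(2 * Real.pi * Complex.I * (2 ^ (t - 1 - i) * 2 ^ (l : ℕ)) / 2 ^ t))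
        else 1 := by
    have : -(2 * Real.pi * Complex.I * (val a * rval b : ℕ) / (2 ^ t : ℕ)) =
        ∑ i : Fin t, ∑ l : Fin t, if b l = true ∧ a i = true then
        -(2 * Real.pi * Complex.I * (2 ^ (t - 1 - i) * 2 ^ (l : ℕ)) / 2 ^ t) else 0 := by
      rw [val, rval, Finset.sum_mul_sum]
      push_cast
      rw [Finset.mul_sum, Finset.sum_div, ← Finset.sum_neg_distrib]
      refine Finset.sum_congr rfl fun i _ => ?_
      rw [Finset.mul_sum, Finset.sum_div, ← Finset.sum_neg_distrib]
      refine Finset.sum_congr rfl fun l _ => ?_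
      cases a i <;> cases b l <;> simp
    rw [this, Complex.exp_sum]
    refine Finset.prod_congr rfl fun i _ => ?_
    rw [Complex.exp_sum]
    refine Finset.prod_congr rfl fun l _ => ?_
    split_ifs <;> simp
  have hc : (Real.sqrt 2 : ℂ) ^ t = ∏ _i : Fin t, (Real.sqrt 2 : ℂ) := by simp
  rw [hexp, hc, ← Finset.prod_div_distrib]
  refine Finset.prod_congr rfl fun i _ => ?_
  have hterm : ∀ l : Fin t, (if b l = true ∧ a i = true then
        Complex.exp (-(2 * Real.pi * Complex.I * (2 ^ (t - 1 - i) * 2 ^ (l : ℕ)) / 2 ^ t))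
        else 1) = (if l = i then (if a i && b i then -1 else 1) else 1) *
      if l < i ∧ b l = true ∧ a i = true then
    Complex.exp ((-(Real.pi / 2 ^ ((i : ℕ) - l)) : ℝ) * Complex.I) else 1 := by
    intro l
    have hti : (2 : ℂ) ^ t = 2 ^ (t - 1 - i) * (2 ^ (i : ℕ) * 2) := by
      rw [← pow_succ, ← pow_add]; congr 1; have := i.isLt; omega
    rcases lt_trichotomy l i with h | h | h
    · have hli : (2 : ℂ) ^ (i : ℕ) = 2 ^ (l : ℕ) * 2 ^ ((i : ℕ) - l) := by
        rw [← pow_add]; congr 1; have : (l : ℕ) < i := h; omega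
      rw [if_neg h.ne, one_mul]
      simp only [h, true_and]
      refine if_congr Iff.rfl ?_ rfl
      congr 1
      rw [hti, hli]
      push_cast
      field_simp
    · subst h
      simp only [lt_irrefl, false_and, if_false, if_true, mul_one, Bool.and_eq_true]
      refine if_congr and_comm ?_ rfl
      rw [← Complex.exp_pi_mul_I, ← Complex.exp_periodic.sub_eq (Real.pi * Complex.I)]
      congr 1
      rw [hti]
      field_simp
      ring
    · have hli : (2 : ℂ) ^ (l : ℕ) = 2 ^ (i : ℕ) * 2 * 2 ^ ((l : ℕ) - i - 1) := by
        rw [← pow_succ, ← pow_add]; congr 1; have : (i : ℕ) < l := h; omega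
      simp only [if_neg h.ne', h.le.not_gt, false_and, if_false, one_mul]
      split_ifs
      · rw [Complex.exp_eq_one_iff]
        refine ⟨-(2 ^ ((l : ℕ) - i - 1)), ?_⟩
        rw [hti, hli]
        push_cast
        field_simp
      · rfl
  simp only [hterm]
  rw [Finset.prod_mul_distrib, Finset.prod_ite_eq' Finset.univ i, if_pos (Finset.mem_univ i),
    fourierFactor, hadamard, Matrix.of_apply]
  ring

theorem runOps_fourierOps_withOutput (U V : Matrix (Bits q) (Bits q) ℂ)
    (φ : Bits t × (Bool × Bits q) → ℂ) (r : Bool) :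
    runOps U V (fourierOps t q m t) (withOutput m φ fun _ => r) =
      withOutput m (fun p => ∑ b : Bits t,
        Complex.exp (-(2 * Real.pi * Complex.I * (val p.1 * rval b : ℕ) / (2 ^ t : ℕ))) /
          (Real.sqrt 2 : ℂ) ^ t * φ (b, p.2)) (fun _ => r) := by
  ext x
  rw [runOps_fourierOps U V t le_rfl]
  have h1 : ∀ b : Bits t, (∀ i : Fin t, i + t < t → b i = x (Wire.phase i)) :=
    fun b i hi => by omega
  have h2 : ∀ b : Bits t, (∏ i : Fin t, if t ≤ i + t then fourierFactor (getPhase x) b i else 1) =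
      Complex.exp (-(2 * Real.pi * Complex.I * (val (getPhase x) * rval b : ℕ) / (2 ^ t : ℕ))) /
          (Real.sqrt 2 : ℂ) ^ t := by
    intro b
    rw [← prod_fourierFactor]
    exact Finset.prod_congr rfl fun i _ => if_pos (by omega)
  rw [Finset.sum_congr rfl fun b _ => if_pos (h1 b)]
  simp only [h2, withOutput]
  have h3 : ∀ b : Bits t, (setPhase x b Wire.out = r ∧ ∀ i, setPhase x b (Wire.ancilla i) = false) ↔
      (x Wire.out = r ∧ ∀ i, x (Wire.ancilla i) = false) := fun b => Iff.rfl
  simp only [h3]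
  split_ifs
  · rfl
  · simp

end Fourier

/-! ## The main circuit -/

section Main
variable {t q M m : ℕ}

theorem onWork_withOutput (B : Bits t → Matrix (Bool × Bits q) (Bool × Bits q) ℂ)
    (φ : Bits t × (Bool × Bits q) → ℂ) (r : Bits t → Bool) :
    onWork (fun x => B (getPhase x)) (withOutput m φ r) =
      withOutput m (fun p => (B p.1 *ᵥ fun y => φ (p.1, y)) p.2) r := by
  ext x
  have h : ∀ y, withOutput m φ r (setWork x y) =
      if x Wire.out = r (fun i => x (Wire.phase i)) ∧ ∀ i, x (Wire.ancilla i) = false then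
        φ (getPhase x, y) else 0 := fun y => rfl
  simp only [onWork, h]
  rw [withOutput]
  split_ifs
  · rfl
  · simp

/-- The action of a list of steps. -/
noncomputable def runSteps (P : Circuit t q m) (U V : Matrix (Bits q) (Bits q) ℂ)
    (l : List (Step q (Wire t q m))) (ψ : (Wire t q m → Bool) → ℂ) : (Wire t q m → Bool) → ℂ :=
  l.foldl (P.runStep U V) ψ

theorem runSteps_append (P : Circuit t q m) (U V : Matrix (Bits q) (Bits q) ℂ)
    (l l' : List (Step q (Wire t q m))) (ψ : (Wire t q m → Bool) → ℂ) :
    runSteps P U V (l ++ l') ψ = runSteps P U V l' (runSteps P U V l ψ) := by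
  simp [runSteps]

theorem runSteps_map_op (P : Circuit t q m) (U V : Matrix (Bits q) (Bits q) ℂ)
    (l : List (Op q (Wire t q m))) (ψ : (Wire t q m → Bool) → ℂ) :
    runSteps P U V (l.map .op) ψ = runOps U V l ψ := by
  rw [runSteps, List.foldl_map]
  rfl

theorem runSteps_sub (P : Circuit t q (M + 1)) {U V : Matrix (Bits q) (Bits q) ℂ}
    {Q : Matrix (Bool × Bits q) (Bool × Bits q) ℂ}
    (hP : ∀ ψ, Clean ψ → P.runBody U V ψ =
      onWork (fun x => if x (Wire.ancilla 0) = true then Q else 1) ψ) (n : ℕ)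
    {ψ : (Wire t q (M + 1) → Bool) → ℂ} (hψ : Clean ψ) :
    runSteps P U V (List.replicate n .sub) ψ =
      onWork (fun x => if x (Wire.ancilla 0) = true then Q ^ n else 1) ψ := by
  induction n generalizing ψ with
  | zero =>
    simp only [pow_zero, ite_self, onWork_one]
    rfl
  | succ n ih =>
    change runSteps P U V (List.replicate n .sub) (P.runBody U V ψ) = _
    rw [hP ψ hψ, ih (hψ.onWork _), onWork_onWork _ _ (fun _ _ => rfl)]
    congr 1
    ext1 x
    cases x (Wire.ancilla 0)
    · simp
    · simp [pow_succ]

/-- Copying the phase qubit `i` to the control of the subcircuit. -/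
def loadTog (i : Fin t) : Wire t q (M + 1) × Wire t q (M + 1) × Wire t q (M + 1) :=
  (Wire.phase i, Wire.phase i, Wire.ancilla 0)

theorem tog_loadTog_setWork (i : Fin t) (x : Wire t q (M + 1) → Bool) (y : Bool × Bits q) :
    tog (loadTog i) (setWork x y) = setWork (tog (loadTog i) x) y := by
  have h : ∀ b, Function.update (setWork x y) (Wire.ancilla 0) b =
      setWork (Function.update x (Wire.ancilla 0) b) y := by
    intro b
    ext v
    rcases v with (v | v | v) | v | v
    · simp [setWork]
    · simp [setWork]
    · simp [setWork]
    · simp [setWork]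
    · by_cases hv : v = 0
      · subst hv; simp [setWork]
      · simp [setWork, hv]
  cases hx : x (Wire.phase i) <;> simp [tog, loadTog, hx, h]

/-- Copying the phase qubit to the zero control ancilla makes each subcircuit call controlled by
that qubit. The calls change neither wire, so the second copy clears the ancilla. -/
theorem runSteps_powerBlock (P : Circuit t q (M + 1)) {U V : Matrix (Bits q) (Bits q) ℂ}
    {Q : Matrix (Bool × Bits q) (Bool × Bits q) ℂ}
    (hP : ∀ ψ, Clean ψ → P.runBody U V ψ =
      onWork (fun x => if x (Wire.ancilla 0) = true then Q else 1) ψ) (n : ℕ) (i : Fin t)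
    (φ : Bits t × (Bool × Bits q) → ℂ) (r : Bits t → Bool) :
    runSteps P U V ((toggles q [loadTog i]).map .op ++ List.replicate n .sub ++
      (toggles q [loadTog i]).map .op) (withOutput (M + 1) φ r) =
      withOutput (M + 1) (fun p => ((if p.1 i = true then Q ^ n else 1) *ᵥ
        fun y => φ (p.1, y)) p.2) r := by
  have hclean : Clean fun x => withOutput (M + 1) φ r (tog (loadTog i) x) := by
    rintro x ⟨j, hj, hx⟩
    unfold withOutput
    beta_reduce
    rw [if_neg]
    rintro ⟨-, h⟩
    have := h j
    rw [tog_of_ne _ _ (by simpa [loadTog] using hj), hx] at this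
    exact absurd this (by simp)
  rw [runSteps_append, runSteps_append, runSteps_map_op, runSteps_map_op, runOps_toggles,
    runOps_toggles]
  change (fun x => runSteps P U V _ (fun x => withOutput (M + 1) φ r (tog (loadTog i) x))
    (tog (loadTog i) x)) = _
  rw [runSteps_sub P hP n hclean, ← onWork_withOutput
    (fun a => if a i = true then Q ^ n else 1)]
  ext x
  simp only [onWork, ← tog_loadTog_setWork, tog_tog]
  refine Finset.sum_congr rfl fun y _ => ?_
  by_cases hx : ∀ j, x (Wire.ancilla j) = false
  · congr 1
    have h1 : tog (loadTog i) x (Wire.ancilla 0) = x (Wire.phase i) := by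
      have h0 := hx 0
      cases h : x (Wire.phase i) <;> simp [tog, loadTog, h, h0]
    have h2 : getWork (tog (loadTog i) x) = getWork x := by
      rw [getWork, getWork, tog_of_ne _ _ (by simp [loadTog])]
      congr 1
      ext j
      rw [tog_of_ne _ _ (by simp [loadTog])]
    rw [h1, h2]
    rfl
  · have : withOutput (M + 1) φ r (setWork x y) = 0 := by
      rw [withOutput, if_neg]
      rintro ⟨-, h⟩
      exact hx h
    rw [this, mul_zero, mul_zero]

/-- The controlled powers of the Grover iterator for the first `n` phase qubits; the qubit `i`
controls the power `2 ^ i`. -/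
def powerSteps (t q M : ℕ) : ℕ → List (Step q (Wire t q (M + 1)))
  | 0 => []
  | n + 1 => powerSteps t q M n ++ if h : n < t then
      (toggles q [loadTog (⟨n, h⟩ : Fin t)]).map .op ++ List.replicate (2 ^ n) .sub ++
        (toggles q [loadTog (⟨n, h⟩ : Fin t)]).map .op else []

/-- Powers of one matrix multiply by adding exponents. For `n = t` the exponent is `rval` of the
phase register, matching the bit order of the Fourier circuit. -/
theorem runSteps_powerSteps (P : Circuit t q (M + 1)) {U V : Matrix (Bits q) (Bits q) ℂ}
    {Q : Matrix (Bool × Bits q) (Bool × Bits q) ℂ}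
    (hP : ∀ ψ, Clean ψ → P.runBody U V ψ =
      onWork (fun x => if x (Wire.ancilla 0) = true then Q else 1) ψ) (n : ℕ) (hn : n ≤ t)
    (φ : Bits t × (Bool × Bits q) → ℂ) (r : Bits t → Bool) :
    runSteps P U V (powerSteps t q M n) (withOutput (M + 1) φ r) =
      withOutput (M + 1) (fun p => (Q ^ (∑ i : Fin t, if i < n ∧ p.1 i = true then 2 ^ (i : ℕ)
        else 0) *ᵥ fun y => φ (p.1, y)) p.2) r := by
  induction n with
  | zero =>
    change withOutput (M + 1) φ r = _
    simp
  | succ n ih =>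
    rw [powerSteps, dif_pos (by omega), runSteps_append, ih (by omega), runSteps_powerBlock P hP]
    congr 1
    ext ⟨a, y⟩
    dsimp only
    change ((if a ⟨n, by omega⟩ = true then Q ^ 2 ^ n else 1) *ᵥ
      (Q ^ (∑ i : Fin t, if (i : ℕ) < n ∧ a i = true then 2 ^ (i : ℕ) else 0) *ᵥ
        fun y => φ (a, y))) y = _
    rw [Matrix.mulVec_mulVec]
    congr 2
    have hs : (∑ i : Fin t, if (i : ℕ) < n + 1 ∧ a i = true then 2 ^ (i : ℕ) else 0) =
        (∑ i : Fin t, if (i : ℕ) < n ∧ a i = true then 2 ^ (i : ℕ) else 0) +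
          if a ⟨n, by omega⟩ = true then 2 ^ n else 0 := by
      have h1 : ∀ i : Fin t, (if (i : ℕ) < n + 1 ∧ a i = true then 2 ^ (i : ℕ) else 0) =
          (if (i : ℕ) < n ∧ a i = true then 2 ^ (i : ℕ) else 0) +
            if i = (⟨n, by omega⟩ : Fin t) then (if a i = true then 2 ^ (i : ℕ) else 0) else 0 := by
        intro i
        have h2 : i = (⟨n, by omega⟩ : Fin t) ↔ (i : ℕ) = n := Fin.ext_iff
        simp only [h2]
        rcases lt_trichotomy (i : ℕ) n with h | h | h
        · simp [h, h.ne, show (i : ℕ) < n + 1 by omega]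
        · simp [h]
        · simp [h.ne', h.le.not_gt, show ¬ (i : ℕ) < n + 1 by omega]
      simp only [h1, Finset.sum_add_distrib, Finset.sum_ite_eq', Finset.mem_univ, if_true]
    rw [hs, pow_add]
    split_ifs
    · rw [← pow_add, ← pow_add, add_comm]
    · simp

/-- The wires of the phase register in increasing order of significance. -/
def phaseWire (t q M : ℕ) (i : ℕ) : Wire t q (M + 1) :=
  if h : i < t then Wire.phase ⟨t - 1 - i, by omega⟩ else Wire.aux

/-- The gates that compute whether the phase register holds a number greater than `K`. -/
def compareTogs (t q M K : ℕ) : List (Wire t q (M + 1) × Wire t q (M + 1) × Wire t q (M + 1)) :=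
  ladder (fun i b v => if K.testBit i then b && v else b || v) (phaseWire t q M) (chain t q M) t

/-- Comparison from the least significant bit upwards: the new top bit decides if it differs from
that of `K`, otherwise the earlier result `v` stands. This is `b && v` or `b || v` according to the
bit of `K`. -/
theorem ladderVal_lt (K : ℕ) (inp : ℕ → Bool) (n : ℕ) :
    ladderVal (fun i b v => if K.testBit i then b && v else b || v) inp false n =
      decide (K % 2 ^ n < ∑ i ∈ Finset.range n, if inp i then 2 ^ i else 0) := by
  have hlt : ∀ n, (∑ i ∈ Finset.range n, if inp i then 2 ^ i else 0) < 2 ^ n := by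
    intro n
    induction n with
    | zero => simp
    | succ n ih =>
      rw [Finset.sum_range_succ, pow_succ]
      split_ifs <;> omega
  induction n with
  | zero => simp [ladderVal, Nat.mod_one]
  | succ n ih =>
    rw [ladderVal, ih, Nat.mod_pow_succ, ← Nat.toNat_testBit, Finset.sum_range_succ]
    have h1 := hlt n
    have h2 := Nat.mod_lt K (Nat.two_pow_pos n)
    cases K.testBit n <;> cases inp n <;>
      simp only [Bool.false_eq_true, if_true, if_false, Bool.false_and, Bool.true_and,
        Bool.false_or, Bool.true_or, Bool.toNat_true, Bool.toNat_false, mul_zero, mul_one,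
        add_zero] <;> symm
    · rw [decide_eq_true_iff]; omega
    · rw [decide_eq_false_iff_not]; omega
    · exact decide_eq_decide.2 (by omega)

theorem val_getPhase (x : Wire t q (M + 1) → Bool) : val (getPhase x) =
    ∑ i ∈ Finset.range t, if x (phaseWire t q M i) then 2 ^ i else 0 := by
  rw [val, ← Equiv.sum_comp Fin.revPerm, Finset.sum_range]
  refine Finset.sum_congr rfl fun i _ => ?_
  have h1 : t - 1 - (Fin.revPerm i : ℕ) = i := by
    rw [Fin.revPerm_apply, Fin.val_rev]; have := i.isLt; omega
  have h2 : phaseWire t q M i = Wire.phase (Fin.revPerm i) := by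
    rw [phaseWire, dif_pos i.isLt]
    congr 1
    ext
    rw [Fin.revPerm_apply, Fin.val_rev]; simp only; omega
  rw [h1, h2]
  rfl

/-- The operations that add to the output qubit whether the phase register holds a number greater
than `K`. -/
def compareOps (t q M K : ℕ) : List (Op q (Wire t q (M + 1))) :=
  toggles q (compareTogs t q M K ++ [(chain t q M t, chain t q M t, Wire.out)] ++
    (compareTogs t q M K).reverse)

theorem phaseWire_ne_inr (i : ℕ) (v : Unit ⊕ Fin (M + 1)) : phaseWire t q M i ≠ Sum.inr v := by
  rw [phaseWire]
  split_ifs <;> simp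

/-- The comparison ladder reuses the ancillas of the subcircuit; its first wire, the control, is
zero here and serves as the initial value `false`. -/
theorem runOps_compareOps (U V : Matrix (Bits q) (Bits q) ℂ) (hM : t ≤ M) {K : ℕ} (hK : K < 2 ^ t)
    (φ : Bits t × (Bool × Bits q) → ℂ) (r : Bits t → Bool) :
    runOps U V (compareOps t q M K) (withOutput (M + 1) φ r) =
      withOutput (M + 1) φ (fun a => xor (r a) (decide (K < val a))) := by
  have ho : Avoids Wire.out (compareTogs t q M K) :=
    avoids_ladder _ _ _ _ _ (fun i _ => by simp [chain])
      (fun i _ => (phaseWire_ne_inr i _).symm)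
  rw [compareOps, runOps_compute_copy U V ho (by simp [chain])]
  ext x
  by_cases hx : ∀ j, x (Wire.ancilla j) = false
  · have h1 : fwd (compareTogs t q M K) x (chain t q M t) = decide (K < val (getPhase x)) := by
      rw [compareTogs, (fwd_ladder _ _ _ _ x (fun i j hi hj => chain_inj (by omega) (by omega))
        (fun i j _ _ => phaseWire_ne_inr i _) (fun j _ _ => hx _)).1]
      rw [show x (chain t q M 0) = false from hx _, ladderVal_lt, Nat.mod_eq_of_lt hK,
        val_getPhase]
    rw [h1, withOutput, withOutput]
    have h2 : ∀ b, ∀ j, Function.update x Wire.out b (Wire.ancilla j) = false := by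
      intro b j
      rw [Function.update_of_ne (by simp)]
      exact hx j
    simp only [h2, hx, implies_true, and_true, Function.update_self]
    refine if_congr ?_ rfl rfl
    change xor (x Wire.out) (decide (K < val (getPhase x))) = r (getPhase x) ↔
      x Wire.out = xor (r (getPhase x)) (decide (K < val (getPhase x)))
    cases x Wire.out <;> cases decide (K < val (getPhase x)) <;> cases r (getPhase x) <;> simp
  · rw [withOutput, withOutput, if_neg, if_neg]
    · exact fun h => hx h.2
    · rintro ⟨-, h⟩
      refine hx fun j => ?_
      have := h j
      rwa [Function.update_of_ne (by simp)] at this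

theorem ket_eq_withOutput : (ket fun _ => false : (Wire t q m → Bool) → ℂ) =
    withOutput m (ket (zeros t, (false, zeros q))) fun _ => false := by
  ext x
  rw [withOutput, ket, Pi.single_apply, ket, Pi.single_apply, ← ite_and]
  refine if_congr ?_ rfl rfl
  constructor
  · rintro rfl
    exact ⟨⟨rfl, fun _ => rfl⟩, rfl⟩
  · rintro ⟨⟨h1, h2⟩, h3⟩
    have h4 := congrFun (congrArg Prod.fst h3)
    have h5 := congrArg (fun p : Bits t × (Bool × Bits q) => p.2.1) h3
    have h6 := congrFun (congrArg (fun p : Bits t × (Bool × Bits q) => p.2.2) h3)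
    ext v
    rcases v with (v | v | v) | v | v
    exacts [h4 v, h5, h6 v, h1, h2 v]

/-- The circuit of the routine. On the all-zero state the Fourier transform prepares the same uniform
superposition as Hadamard gates; the output is computed by comparing the phase register with `K`
and with `K'`. -/
noncomputable def signEstCircuit (t M K K' : ℕ) (k : Bits q) : Circuit t q (M + 1) where
  main := (fourierOps t q (M + 1) t ++ prepOps t (M + 1) k).map .op ++ powerSteps t q M t ++
    (fourierOps t q (M + 1) t ++ compareOps t q M K ++ compareOps t q M K').map .op
  body := bodyOps t M k
  ctrl := 0

theorem rval_comp_rev (b : Bits t) : rval (fun i => b (Fin.rev i)) = val b := by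
  rw [rval, val, ← Equiv.sum_comp Fin.revPerm]
  refine Finset.sum_congr rfl fun i _ => ?_
  have : (Fin.revPerm i : ℕ) = t - 1 - i := by
    rw [Fin.revPerm_apply, Fin.val_rev]; have := i.isLt; omega
  rw [this]
  simp

/-- Both the powers and the final Fourier kernel read the phase register through `rval`, whereas the
routine reads it through `val` in both places. The register is summed over, so reversing its bits
identifies the two sums. -/
theorem signEstCircuit_run {U V : Matrix (Bits q) (Bits q) ℂ}
    (hV : V ∈ Matrix.unitaryGroup (Bits q) ℂ) (hM : q + 1 ≤ M) (hM' : t ≤ M) {K K' : ℕ}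
    (hK : K < 2 ^ t) (hK' : K' < 2 ^ t) (k : Bits q) :
    (signEstCircuit t M K K' k).run U V =
      withOutput (M + 1) (ampEstState t (prep V k) (false, zeros q) (false, k))
        (fun a => xor (decide (K < val a)) (decide (K' < val a))) := by
  have hP : ∀ ψ, Clean ψ → (signEstCircuit t M K K' k).runBody U V ψ =
      onWork (fun x => if x (Wire.ancilla 0) = true then iterator V k else 1) ψ :=
    fun ψ hψ => runOps_bodyOps U hV hM k hψ
  change runSteps (signEstCircuit t M K K' k) U V (_ ++ _ ++ _) (ket fun _ => false) = _
  rw [runSteps_append, runSteps_append, runSteps_map_op, runSteps_map_op, runOps_append,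
    runOps_append, runOps_append, ket_eq_withOutput, runOps_fourierOps_withOutput, runOps_prepOps,
    onWork_withOutput fun _ => prep V k, runSteps_powerSteps _ hP t le_rfl,
    runOps_fourierOps_withOutput, runOps_compareOps U V hM' hK, runOps_compareOps U V hM' hK']
  simp only [Bool.false_xor]
  congr 1
  ext ⟨a, y⟩
  have h2 : (Real.sqrt 2 : ℂ) ^ t * (Real.sqrt 2 : ℂ) ^ t = (2 ^ t : ℕ) := by
    rw [← mul_pow]
    norm_cast
    rw [Real.mul_self_sqrt (by norm_num)]
    norm_cast
  -- On the zero state the kernel is `exp 0` for every outcome, so the first Fourier transform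
  -- produces the uniform superposition.
  have h1 : ∀ b : Bits t, (fun y => ((fun _ : Bits t => prep V k) b *ᵥ fun y : Bool × Bits q =>
      ∑ c : Bits t, Complex.exp (-(2 * Real.pi * Complex.I * (val b * rval c : ℕ) /
        (2 ^ t : ℕ))) / (Real.sqrt 2 : ℂ) ^ t * ket (zeros t, (false, zeros q)) (c, y)) y) =
      (1 / (Real.sqrt 2 : ℂ) ^ t) • (prep V k *ᵥ ket (false, zeros q)) := by
    intro b
    rw [← Matrix.mulVec_smul]
    change prep V k *ᵥ _ = _
    congr 1
    ext y
    rw [Finset.sum_eq_single (zeros t)]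
    · by_cases h : y = (false, zeros q)
      · subst h; simp [ket, rval, zeros]
      · simp [ket, h]
    · intro c _ hc
      simp [ket, hc]
    · simp
  have hr : ∀ b : Bits t, (∑ i : Fin t, if (i : ℕ) < t ∧ b i = true then 2 ^ (i : ℕ) else 0) =
      rval b := fun b => Finset.sum_congr rfl fun i _ => by simp
  dsimp only at h1 ⊢
  simp only [h1, hr]
  rw [ampEstState_apply]
  let e : Bits t ≃ Bits t := Equiv.arrowCongr Fin.revPerm (Equiv.refl Bool)
  have he : ∀ j, rval (e j) = val j := fun j => rval_comp_rev j
  rw [← e.sum_comp]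
  refine Finset.sum_congr rfl fun j _ => ?_
  rw [he, Matrix.mulVec_smul, ← h2, mul_comm (val a)]
  simp only [Pi.smul_apply, smul_eq_mul, iterator]
  generalize Complex.exp _ = z
  ring

end Main

/-! ### Gate, subcircuit and oracle counts of the main circuit -/

section MainCounts
variable {t q M m : ℕ}

theorem length_fourierOps_le (n : ℕ) : (fourierOps t q m n).length ≤ n * (t + 1) := by
  induction n with
  | zero => simp [fourierOps]
  | succ n ih =>
    rw [fourierOps, List.length_append, Nat.succ_mul]
    refine Nat.add_le_add ih ?_
    split_ifs
    · have h := List.length_filter_le (fun l => decide (l < (⟨t - 1 - n, by omega⟩ : Fin t)))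
        (List.finRange t)
      rw [List.length_finRange] at h
      rw [fourierBlock, List.length_cons, List.length_map]
      omega
    · simp

theorem countP_not_fourierOps (n : ℕ) :
    (fourierOps t q m n).countP (fun o => !o.isGate) = 0 := by
  induction n with
  | zero => rfl
  | succ n ih =>
    rw [fourierOps, List.countP_append, ih, zero_add]
    split_ifs
    · rw [List.countP_eq_zero]
      intro o ho
      rw [fourierBlock, List.mem_cons, List.mem_map] at ho
      rcases ho with rfl | ⟨l, -, rfl⟩ <;> simp [Op.isGate]
    · rfl

theorem countP_compareOps_le (K : ℕ) :
    (compareOps t q M K).countP Op.isGate ≤ 8 * t + 1 := by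
  have := length_ladder_le (fun i b v => if K.testBit i then b && v else b || v)
    (phaseWire t q M) (chain t q M) t
  rw [compareOps, countP_toggles, compareTogs]
  simp only [List.length_append, List.length_reverse, List.length_singleton]
  omega

/-- Whether a step of the main circuit is a call of the subcircuit. -/
def Step.isSub {W : Type*} : Step q W → Bool
  | .sub => true
  | .op _ => false

/-- Whether a step of the main circuit is a basic gate. -/
def Step.isMainGate {W : Type*} : Step q W → Bool
  | .sub => false
  | .op o => o.isGate

/-- Whether a step of the main circuit is a call of the oracle. -/
def Step.isQuery {W : Type*} : Step q W → Bool
  | .sub => false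
  | .op o => !o.isGate

theorem countP_map_op {W : Type*} (p : Step q W → Bool) (l : List (Op q W)) :
    (l.map Step.op).countP p = l.countP fun o => p (.op o) := by
  rw [List.countP_map]; rfl

/-- The calls form the geometric sum `1 + 2 + ⋯ + 2^(n-1)`; the added `1` avoids truncated
subtraction. The gates are the two copies in each block. -/
theorem countP_powerSteps (n : ℕ) (hn : n ≤ t) :
    (powerSteps t q M n).countP Step.isSub + 1 = 2 ^ n ∧
      (powerSteps t q M n).countP Step.isMainGate = 2 * n ∧
      (powerSteps t q M n).countP Step.isQuery = 0 := by
  induction n with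
  | zero => exact ⟨rfl, rfl, rfl⟩
  | succ n ih =>
    obtain ⟨h1, h2, h3⟩ := ih (by omega)
    have e1 : ∀ i : Fin t, (toggles q [(loadTog i : _ × _ × Wire t q (M + 1))]).countP
      (fun o => Step.isSub (Step.op o)) = 0 := fun i => rfl
    have e2 : ∀ i : Fin t, (toggles q [(loadTog i : _ × _ × Wire t q (M + 1))]).countP
      (fun o => Step.isMainGate (Step.op o)) = 1 := fun i => rfl
    have e3 : ∀ i : Fin t, (toggles q [(loadTog i : _ × _ × Wire t q (M + 1))]).countP
      (fun o => Step.isQuery (Step.op o)) = 0 := fun i => rfl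
    simp only [powerSteps, dif_pos (show n < t by omega), List.countP_append, countP_map_op, e1,
      e2, e3, List.countP_replicate, h2, h3, pow_succ]
    simp only [Step.isSub, Step.isMainGate, Step.isQuery]
    refine ⟨?_, ?_, ?_⟩ <;> simp <;> omega

theorem subCalls_signEstCircuit (K K' : ℕ) (k : Bits q) :
    (signEstCircuit t M K K' k).subCalls + 1 = 2 ^ t := by
  have h0 : ∀ l : List (Op q (Wire t q (M + 1))), (l.map Step.op).countP Step.isSub = 0 := by
    intro l
    rw [countP_map_op, List.countP_eq_zero]
    simp [Step.isSub]
  have h : (signEstCircuit t M K K' k).subCalls =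
    (signEstCircuit t M K K' k).main.countP Step.isSub := by
      unfold Circuit.subCalls
      congr 1
      ext1 s
      cases s <;> rfl
  rw [h, signEstCircuit, List.countP_append, List.countP_append, h0, h0, zero_add, add_zero]
  exact (countP_powerSteps t le_rfl).1

theorem mainGates_signEstCircuit_le (K K' : ℕ) (k : Bits q) :
    (signEstCircuit t M K K' k).mainGates ≤ 2 * (t * (t + 1)) + 18 * t + q + 6 := by
  have h : (signEstCircuit t M K K' k).mainGates =
    (signEstCircuit t M K K' k).main.countP Step.isMainGate := by
      unfold Circuit.mainGates
      congr 1
      ext1 s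
      cases s <;> rfl
  have h0 : ∀ l : List (Op q (Wire t q (M + 1))), (l.map Step.op).countP Step.isMainGate =
      l.countP Op.isGate := fun l => countP_map_op _ l
  have hf : (fourierOps t q (M + 1) t).countP Op.isGate ≤ t * (t + 1) :=
    (List.countP_le_length).trans (length_fourierOps_le t)
  have hp := countP_prepOps_le (t := t) (m := M + 1) k
  have hc := countP_compareOps_le (t := t) (q := q) (M := M) K
  have hc' := countP_compareOps_le (t := t) (q := q) (M := M) K'
  have hs := (countP_powerSteps (t := t) (q := q) (M := M) t le_rfl).2.1
  rw [h, signEstCircuit]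
  simp only [List.countP_append, h0, hs]
  omega

/-- One call in the preparation, and two in each of the `2^t - 1` calls of the subcircuit. -/
theorem queries_signEstCircuit (K K' : ℕ) (k : Bits q) :
    (signEstCircuit t M K K' k).queries + 1 = 2 * 2 ^ t := by
  have h : (signEstCircuit t M K K' k).queries =
    (signEstCircuit t M K K' k).main.countP Step.isQuery +
      (signEstCircuit t M K K' k).subCalls * (bodyOps t M k).countP (fun o => !o.isGate) := by
      unfold Circuit.queries
      congr 2
      ext1 s
      cases s <;> rfl
  have h0 : ∀ l : List (Op q (Wire t q (M + 1))), (l.map Step.op).countP Step.isQuery =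
      l.countP fun o => !o.isGate := fun l => countP_map_op _ l
  have hm : (signEstCircuit t M K K' k).main.countP Step.isQuery = 1 := by
    rw [signEstCircuit]
    simp only [List.countP_append, h0, (countP_powerSteps (t := t) (q := q) (M := M) t le_rfl).2.2,
      countP_not_fourierOps, countP_not_prepOps, compareOps, countP_not_toggles]
  rw [h, hm, countP_not_bodyOps, ← subCalls_signEstCircuit (M := M) K K' k]
  ring

end MainCounts

/-! ### The output comparisons and the final cost bounds -/

/-- The returned value depends on two comparisons of the phase register. -/
theorem exists_returnValue_eq_xor {ε : ℝ} (h0 : 0 < ε) (h1 : ε ≤ 1) (t : ℕ) :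
    ∃ K K' : ℕ, K < 2 ^ t ∧ K' < 2 ^ t ∧ ∀ a : Bits t,
      returnValue ε a = xor (decide (K < val a)) (decide (K' < val a)) := by
  have hpi := Real.pi_gt_three
  have h3 : 1.7 ≤ Real.sqrt 3 := Real.le_sqrt_of_sq_le (by norm_num)
  have hs : 5.1 ≤ Real.sqrt 3 * Real.pi := by nlinarith
  set τ := 1 / 6 - 2 * ε / (3 * Real.sqrt 3 * Real.pi) with hτ
  have hτ1 : τ < 1 / 2 := by
    have : 0 < 2 * ε / (3 * Real.sqrt 3 * Real.pi) := by positivity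
    linarith
  -- Here `ε ≤ 1` enters: `2 / (3 · 5.1) < 1/6`.
  have hτ0 : 0 ≤ τ := by
    have : 2 * ε / (3 * Real.sqrt 3 * Real.pi) ≤ 1 / 6 := by
      rw [div_le_iff₀ (by positivity)]
      nlinarith
    linarith
  have hN : (0 : ℝ) < 2 ^ t := by positivity
  have hK1 : 0 < ⌈(1 - τ) * 2 ^ t⌉₊ := Nat.ceil_pos.2 (mul_pos (by linarith) hN)
  -- The returned value is `1` exactly when `τ < 0.a < 1 - τ`. The floor encodes `τ < 0.a`; the
  -- ceiling minus one encodes the non-strict `1 - τ ≤ 0.a` as a strict comparison. As `τ < 1/2`,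
  -- the second condition implies the first, so their xor is the interval.
  refine ⟨⌊τ * 2 ^ t⌋₊, ⌈(1 - τ) * 2 ^ t⌉₊ - 1, ?_, ?_, fun a => ?_⟩
  · rw [Nat.floor_lt (by positivity)]
    push_cast
    nlinarith
  · have : ⌈(1 - τ) * 2 ^ t⌉₊ ≤ 2 ^ t := by
      rw [Nat.ceil_le]
      push_cast
      nlinarith
    omega
  · have e1 : (⌊τ * 2 ^ t⌋₊ < val a) ↔ τ < frac a := by
      rw [Nat.floor_lt (by positivity), frac_eq, lt_div_iff₀ hN]
    have e2 : (⌈(1 - τ) * 2 ^ t⌉₊ - 1 < val a) ↔ 1 - τ ≤ frac a := by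
      rw [show (⌈(1 - τ) * 2 ^ t⌉₊ - 1 < val a) ↔ ⌈(1 - τ) * 2 ^ t⌉₊ ≤ val a by omega, Nat.ceil_le,
        frac_eq, le_div_iff₀ hN]
    have d1 : decide (⌊τ * 2 ^ t⌋₊ < val a) = decide (τ < frac a) := decide_eq_decide.2 e1
    have d2 : decide (⌈(1 - τ) * 2 ^ t⌉₊ - 1 < val a) = decide (1 - τ ≤ frac a) :=
      decide_eq_decide.2 e2
    rw [d1, d2, returnValue, ← hτ]
    by_cases h : frac a < 1 / 2
    · have : ¬ 1 - τ ≤ frac a := by linarith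
      rw [if_pos h]
      simp [this]
    · have h4 : τ < frac a := by linarith
      rw [if_neg h]
      by_cases h' : 1 - τ ≤ frac a
      · have h5 : ¬ τ < 1 - frac a := by linarith
        simp [h', h4, h5]
      · have h5 : τ < 1 - frac a := by linarith
        simp [h', h4, h5]

/-- The `9` is `6 + 1 + 2`: `9√3π ≤ 2^6`, the rounding of the ceiling, and the two extra qubits. -/
theorem accuracy_le {ε : ℝ} (h0 : 0 < ε) (h1 : ε ≤ 1) :
    (accuracy ε : ℝ) ≤ Real.logb 2 (1 / ε) + 9 := by
  have hpi := Real.pi_gt_three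
  have hpi' := Real.pi_lt_d2
  have h3 : Real.sqrt 3 ≤ 1.8 := Real.sqrt_le_iff.2 ⟨by norm_num, by norm_num⟩
  have h3' : 1 ≤ Real.sqrt 3 := Real.le_sqrt_of_sq_le (by norm_num)
  have hc1 : 1 ≤ 9 * Real.sqrt 3 * Real.pi := by nlinarith
  have hc2 : 9 * Real.sqrt 3 * Real.pi ≤ 2 ^ (6 : ℝ) := by
    norm_num
    nlinarith
  have hε : 1 ≤ 1 / ε := one_le_one_div h0 h1
  have hl : Real.logb 2 (9 * Real.sqrt 3 * Real.pi / ε) =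
      Real.logb 2 (9 * Real.sqrt 3 * Real.pi) + Real.logb 2 (1 / ε) := by
    rw [← Real.logb_mul (by positivity) (by positivity)]
    congr 1
    ring
  have hb0 : 0 ≤ Real.logb 2 (9 * Real.sqrt 3 * Real.pi) := Real.logb_nonneg (by norm_num) hc1
  have hb1 : 0 ≤ Real.logb 2 (1 / ε) := Real.logb_nonneg (by norm_num) hε
  have hb2 : Real.logb 2 (9 * Real.sqrt 3 * Real.pi) ≤ 6 :=
    (Real.logb_le_iff_le_rpow (by norm_num) (by positivity)).2 hc2
  have := Nat.ceil_lt_add_one (a := Real.logb 2 (9 * Real.sqrt 3 * Real.pi / ε))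
    (by rw [hl]; positivity)
  rw [accuracy]
  push_cast
  linarith

theorem two_pow_accuracy_le {ε : ℝ} (h0 : 0 < ε) (h1 : ε ≤ 1) :
    (2 : ℝ) ^ accuracy ε ≤ 512 * (1 / ε) := by
  have h : (2 : ℝ) ^ (accuracy ε : ℝ) ≤ 2 ^ (Real.logb 2 (1 / ε) + 9) :=
    Real.rpow_le_rpow_of_exponent_le (by norm_num) (accuracy_le h0 h1)
  rw [Real.rpow_add (by norm_num), Real.rpow_logb (by norm_num) (by norm_num) (by positivity),
    Real.rpow_natCast] at h
  norm_num at h ⊢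
  linarith

/-- The routine is performed by a circuit of the stated cost. -/
theorem exists_signEstCircuit {q : ℕ} (k : Bits q) {ε : ℝ} (hq : 1 ≤ q) (h0 : 0 < ε)
    (h1 : ε ≤ 1) : ∃ (m : ℕ) (P : Circuit (accuracy ε) q m),
      (P.queries : ℝ) ≤ 2000 * (1 / ε) ∧ (P.subCalls : ℝ) ≤ 2000 * (1 / ε) ∧
      (P.bodyGates : ℝ) ≤ 2000 * q ∧
      (P.mainGates : ℝ) ≤ 2000 * (q + Real.logb 2 (1 / ε) ^ 2) ∧
      ∀ (U : Matrix (Bits q) (Bits q) ℂ) (γ : ℝ), U ∈ Matrix.unitaryGroup (Bits q) ℂ →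
        P.Performs ε U (Complex.exp (-(γ * Complex.I)) • U) k := by
  obtain ⟨K, K', hK, hK', hr⟩ := exists_returnValue_eq_xor h0 h1 (accuracy ε)
  have hp := two_pow_accuracy_le h0 h1
  have hε : 0 < 1 / ε := by positivity
  have hq' : (1 : ℝ) ≤ q := by exact_mod_cast hq
  -- One ancilla is the control; the other `q + accuracy ε + 1` are enough for the matching ladder
  -- as well as for the comparison ladder.
  refine ⟨q + accuracy ε + 1 + 1, signEstCircuit (accuracy ε) (q + accuracy ε + 1) K K' k,
    ?_, ?_, ?_, ?_, fun U γ hU => ⟨fun ψ hψ => ?_, ?_⟩⟩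
  · have h := queries_signEstCircuit (t := accuracy ε) (M := q + accuracy ε + 1) K K' k
    have h' : ((signEstCircuit (accuracy ε) (q + accuracy ε + 1) K K' k).queries : ℝ) + 1 =
      2 * 2 ^ accuracy ε := by exact_mod_cast h
    linarith
  · have h := subCalls_signEstCircuit (t := accuracy ε) (M := q + accuracy ε + 1) K K' k
    have h' : ((signEstCircuit (accuracy ε) (q + accuracy ε + 1) K K' k).subCalls : ℝ) + 1 =
      2 ^ accuracy ε := by exact_mod_cast h
    linarith
  · have h : (signEstCircuit (accuracy ε) (q + accuracy ε + 1) K K' k).bodyGates ≤ 18 * q + 27 :=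
      countP_bodyOps_le k
    have h' : ((signEstCircuit (accuracy ε) (q + accuracy ε + 1) K K' k).bodyGates : ℝ) ≤
      18 * q + 27 := by exact_mod_cast h
    linarith
  · have h := mainGates_signEstCircuit_le (t := accuracy ε) (M := q + accuracy ε + 1) K K' k
    have h' : ((signEstCircuit (accuracy ε) (q + accuracy ε + 1) K K' k).mainGates : ℝ) ≤
      2 * (accuracy ε * (accuracy ε + 1)) + 18 * accuracy ε + q + 6 := by exact_mod_cast h
    have ha := accuracy_le h0 h1
    have hl : 0 ≤ Real.logb 2 (1 / ε) :=
      Real.logb_nonneg (by norm_num) (one_le_one_div h0 h1)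
    have ha0 : (0 : ℝ) ≤ accuracy ε := Nat.cast_nonneg _
    have ha2 : (accuracy ε : ℝ) ^ 2 ≤ (Real.logb 2 (1 / ε) + 9) ^ 2 := by gcongr
    -- With `L = log₂ (1/ε)`, the terms linear in `L` are absorbed by `2L ≤ L² + 1` and the
    -- constants by `q ≥ 1`.
    nlinarith [sq_nonneg (Real.logb 2 (1 / ε) - 1)]
  · have hV := smul_mem_unitaryGroup hU γ
    rw [applyOn_workingRegister]
    exact runOps_bodyOps U hV (by omega) k hψ
  · rw [signEstCircuit_run (smul_mem_unitaryGroup hU γ) (by omega) (by omega) hK hK' k]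
    unfold finalState
    congr 1
    ext1 a
    exact (hr a).symm

end SignEst

theorem mainTheorem6 :
    (∀ (q : ℕ) (U : Matrix (SignEst.Bits q) (SignEst.Bits q) ℂ) (γ : ℝ)
        (α : SignEst.Bits q → ℝ) (k : SignEst.Bits q) (ε : ℝ),
      U ∈ Matrix.unitaryGroup (SignEst.Bits q) ℂ →
      U *ᵥ SignEst.ket (SignEst.zeros q) =
        (fun j => Complex.exp (γ * Complex.I) * (α j : ℂ)) →
      0 < ε →
      3 / 4 ≤ SignEst.probReturn (Complex.exp (-(γ * Complex.I)) • U) k ε (fun r =>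
        (α k ≤ -ε → r = false) ∧ (r = false → α k ≤ 1 / 3 * ε) ∧
        (α k > 1 / 3 * ε → r = true) ∧ (r = true → α k > -ε))) ∧
    (∃ C : ℝ, 0 < C ∧
      ∀ (q : ℕ) (k : SignEst.Bits q) (ε : ℝ), 1 ≤ q → 0 < ε → ε ≤ 1 →
      ∃ (m : ℕ) (P : SignEst.Circuit (SignEst.accuracy ε) q m),
        (P.queries : ℝ) ≤ C * (1 / ε) ∧
        (P.subCalls : ℝ) ≤ C * (1 / ε) ∧
        (P.bodyGates : ℝ) ≤ C * q ∧
        (P.mainGates : ℝ) ≤ C * (q + Real.logb 2 (1 / ε) ^ 2) ∧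
        ∀ (U : Matrix (SignEst.Bits q) (SignEst.Bits q) ℂ) (γ : ℝ),
          U ∈ Matrix.unitaryGroup (SignEst.Bits q) ℂ →
          P.Performs ε U (Complex.exp (-(γ * Complex.I)) • U) k) := by
  exact ⟨fun q U γ α k ε hU hα hε => SignEst.three_quarters_le_probReturn hU hα hε, 2000,
    by norm_num, fun q k ε hq h0 h1 => SignEst.exists_signEstCircuit k hq h0 h1⟩
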